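/- Let $d,L\in\mathbb N$ and let $0=t_0<t_1<\dots<t_L=T$ be a time grid. Let $s_\theta:\mathbb R^d\times\mathbb R\to\mathbb R^d$, and consider the reverse-time chain $\bar X_{t_L}\sim\mathcal N(0,I)$, $$\bar X_{t_{l-1}}\mid \bar X_{t_l}=x\ \sim\ \mathcal N\bigl(\mu_{t_l}(x),\sigma_{t_l}^2I\bigr),\qquad \mu_{t_l}(x)=a_l\,x+b_l\,s_\theta(x,t_l),\qquad 1\le l\le L,$$ with real coefficients satisfying $|a_l|,|b_l|\le B$, with $\sigma_{t_l}\ge0$, and with transition density $\phi_\theta(y\mid x)$ whenever $\sigma_{t_l}>0$. Let $P_{\theta,t_l}$ be the law of $\bar X_{t_l}$. Let $\mathcal E=\{(\bar X_0,U)\in A\}$, where $A$ is a measurable set and $U$ is an auxiliary random variable independent of the chain, and put $$h(x,t_l)=\mathbb P(\mathcal E\mid \bar X_{t_l}=x),\qquad P^h_{\theta,t_l}=\mathrm{Law}(\bar X_{t_l}\mid\mathcal E)\quad\Bigl(\text{which has density } \tfrac{h(\cdot,t_l)}{\mathbb P(\mathcal E)}\text{ with respect to }P_{\theta,t_l}\Bigr).$$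 Assume $\mathbb P(\mathcal E)\ge\rho$ with $\rho\in(0,1]$ and that, for every $l\in\{1,\dots,L\}$, $s_\theta(\cdot,t_l)$ is differentiable with $\sup_x\|\nabla_xs_\theta(x,t_l)\|_2\le G$, $G>0$. Fix $l\in\{1,\dots,L\}$ with $\sigma_{t_l}>0$. Let $z^{(m)}_j$ ($1\le m\le M$, $1\le j\le l$) be i.i.d. $\mathcal N(0,I)$ vectors and, for each $x\in\mathbb R^d$, let $x^{(m)}_{t_l}=x$ and $x^{(m)}_{t_{j-1}}=\mu_{t_j}(x^{(m)}_{t_j})+\sigma_{t_j}z^{(m)}_j$ for $j=l,\dots,1$ (so the same noises are used for every $x$). Define $$\hat h(x,t_l)=\frac1M\sum_{m=1}^M h(x_0^{(m)},0),\qquad \nabla\hat h(x,t_l)=\frac1M\sum_{m=1}^M h(x_0^{(m)},0)\,\nabla_x\log\phi_\theta(x^{(m)}_{t_{l-1}}\mid x),$$ (in the latter, $\phi_\theta(y\mid x)$ is differentiated in $x$ with $y$ held fixed at $x^{(m)}_{t_{l-1}}$), and, with the truncation level $\eta_{t_l}=M^{-1/6}$, $$\nabla\log\hat h(x,t_l)=\frac{\nabla\hat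 h(x,t_l)}{\hat h(x,t_l)\vee\eta_{t_l}} .$$ Then for every $\delta_0\in(0,1)$ there are constants $C>0$ and $M_0\ge 1$, depending only on $d,\rho,G,B$ and $\delta_0$, such that for all such models, all such $l$, all $\delta\in(0,\delta_0]$ and all $M\ge M_0$, with probability at least $1-\delta$ over the noises $z^{(m)}_j$, $$\mathbb E_{X\sim P^h_{\theta,t_l}}\Bigl[\bigl\|\nabla\log\hat h(X,t_l)-\nabla\log h(X,t_l)\bigr\|_2^2\Bigr]\ \le\ C\,\frac1{\sigma_{t_l}^2}\,\frac{\log\frac M\delta\,\sqrt{\log(1/\delta)}}{M^{1/6}} .$$ -/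

import Mathlib

open MeasureTheory ProbabilityTheory

noncomputable section

/-- The state space `ℝ^d` with its Euclidean norm. -/
abbrev Vec (d : ℕ) : Type := EuclideanSpace ℝ (Fin d)

/-- A pre-trained diffusion sampler on `ℝ^d` with `L` reverse steps: a time grid
`0 = t 0 < t 1 < ⋯ < t L = T`, a score network `score x t`, and the schedule of Gaussian reverse
steps from time `t l` to time `t (l - 1)`, for `1 ≤ l ≤ L`, with mean
`a l • x + b l • score x (t l)` and covariance `(σ l)² I`.

The exact one-step solution of `dX = [-X/2 - score(X_{t_l}, t_l)] dt + dW̄` is the case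
`a l = exp (Δ/2)`, `b l = 2 (exp (Δ/2) - 1)`, `(σ l)² = exp Δ - 1` with `Δ = t l - t (l - 1)`;
DDIM and Euler ancestral sampling are further choices of the coefficients. -/
structure DiffusionSampler (d L : ℕ) where
  t : ℕ → ℝ
  t_zero : t 0 = 0
  t_lt : ∀ l, l < L → t l < t (l + 1)
  score : Vec d → ℝ → Vec d
  a : ℕ → ℝ
  b : ℕ → ℝ
  σ : ℕ → ℝ
  σ_nonneg : ∀ l, 0 ≤ σ l

namespace DiffusionSampler

variable {d L : ℕ} (S : DiffusionSampler d L)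

/-- The mean `μ_{t_l}(x, s_θ)` of the reverse step from `t_l` to `t_{l-1}`. -/
def mean (l : ℕ) (x : Vec d) : Vec d := S.a l • x + S.b l • S.score x (S.t l)

/-- The reverse step from `t_l` to `t_{l-1}`, driven by a standard Gaussian vector `z`:
the result has law `N(μ_{t_l}(x, s_θ), σ_{t_l}² I)`. -/
def step (l : ℕ) (x z : Vec d) : Vec d := S.mean l x + S.σ l • z

/-- The Gaussian transition density `φ_θ(y | x)` of the reverse step from `x` at time `t_l` to `y`
at time `t_{l-1}`. -/
def transitionDensity (l : ℕ) (x y : Vec d) : ℝ :=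
  (2 * Real.pi * S.σ l ^ 2) ^ (-(d : ℝ) / 2) *
    Real.exp (-‖y - S.mean l x‖ ^ 2 / (2 * S.σ l ^ 2))

/-- The time-`0` state of the reverse trajectory started from `x` at time `t_l` and driven by the
noises `z_l, z_{l-1}, …, z_1`; the noise of the step from `t_j` to `t_{j-1}` is the entry of `z`
with (zero-based) index `j - 1`. -/
def rollout : (l : ℕ) → Vec d → (Fin l → Vec d) → Vec d
  | 0, x, _ => x
  | l + 1, x, z => rollout l (S.step (l + 1) x (z (Fin.last l))) (Fin.init z)

/-- The law of the generated process after `n` reverse steps, started from `N(0, I)` at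
time `t_L`. -/
def lawAfter : ℕ → Measure (Vec d)
  | 0 => stdGaussian (Vec d)
  | n + 1 => ((lawAfter n).prod (stdGaussian (Vec d))).map fun p => S.step (L - n) p.1 p.2

/-- The marginal law `P_{θ, t_l}` of the generated process at time `t_l`, for `l ≤ L`. -/
def marginal (l : ℕ) : Measure (Vec d) := S.lawAfter (L - l)

end DiffusionSampler

/-- The law of the i.i.d. standard Gaussian noises driving one trajectory of `l` reverse steps. -/
def noiseLaw (d l : ℕ) : Measure (Fin l → Vec d) :=
  Measure.pi fun _ => stdGaussian (Vec d)

/-- The law of the noises driving `M` independent trajectories of `l` reverse steps. -/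
def mcLaw (d l M : ℕ) : Measure (Fin M → Fin l → Vec d) :=
  Measure.pi fun _ => noiseLaw d l

namespace DiffusionSampler

variable {d L : ℕ} (S : DiffusionSampler d L)

/- The conditioning event is given by a set `A ⊆ ℝ^d × 𝒰`: it occurs when `(X̄_0, U) ∈ A`, where `U`
is an auxiliary randomisation with law `ν`, independent of the trajectory. -/
variable {𝒰 : Type*} [MeasurableSpace 𝒰] (ν : Measure 𝒰) (A : Set (Vec d × 𝒰))

/-- The probability of the conditioning event under the generated distribution. -/
def eventProb : ℝ := ((S.marginal 0).prod ν).real A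

/-- Doob's `h`-function `h(x, t_l)`: the probability of the conditioning event when the reverse
process is at `x` at time `t_l`. -/
def doobH (l : ℕ) (x : Vec d) : ℝ :=
  ((noiseLaw d l).prod ν).real {p | (S.rollout l x p.1, p.2) ∈ A}

/-- The law `P^h_{θ, t_l}`: the conditional law of the state at time `t_l` given the conditioning
event. The state at time `t_l`, the later noises and `U` are independent. -/
def tiltedMarginal (l : ℕ) : Measure (Vec d) :=
  (cond ((S.marginal l).prod ((noiseLaw d l).prod ν))
    {p | (S.rollout l p.1 p.2.1, p.2.2) ∈ A}).map Prod.fst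

/-- The Monte Carlo estimator `ĥ(x, t_l)` from `M` rollouts started at `x`. -/
def hHat (l M : ℕ) (z : Fin M → Fin l → Vec d) (x : Vec d) : ℝ :=
  (1 / (M : ℝ)) * ∑ m, S.doobH ν A 0 (S.rollout l x (z m))

/-- The Monte Carlo estimator `∇ĥ(x, t_l)` of the gradient, at `l = k + 1 ≥ 1`: the average of
`h(x_0, 0) ∇_x log φ_θ(y | x)`, with `x_0` the end and `y` the first new state of the rollout. -/
def gradHHat (k M : ℕ) (z : Fin M → Fin (k + 1) → Vec d) (x : Vec d) : Vec d :=
  (1 / (M : ℝ)) • ∑ m, S.doobH ν A 0 (S.rollout (k + 1) x (z m)) •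
    gradient (fun x' => Real.log
      (S.transitionDensity (k + 1) x' (S.step (k + 1) x (z m (Fin.last k))))) x

/-- The truncated plug-in estimator `∇ĥ / (ĥ ∨ η)` of `∇ log h(x, t_l)`, at `l = k + 1 ≥ 1`. -/
def gradLogHHat (k M : ℕ) (η : ℝ) (z : Fin M → Fin (k + 1) → Vec d) (x : Vec d) : Vec d :=
  (max (S.hHat ν A (k + 1) M z x) η)⁻¹ • S.gradHHat ν A k M z x

/-- The mean-squared error of the estimator under `P^h_{θ, t_l}`, at `l = k + 1 ≥ 1`, as a function
of the Monte Carlo noises `z`. -/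
def mse (k M : ℕ) (η : ℝ) (z : Fin M → Fin (k + 1) → Vec d) : ENNReal :=
  ∫⁻ x, ‖S.gradLogHHat ν A k M η z x
      - gradient (fun x' => Real.log (S.doobH ν A (k + 1) x')) x‖ₑ ^ 2
    ∂(S.tiltedMarginal ν A (k + 1))

/-- The conditioning event has probability at least `ρ`, and at every grid time `t_1, …, t_L` the
score is differentiable in `x` with Jacobian of spectral norm at most `G`. -/
structure Regular (ρ G : ℝ) : Prop where
  eventProb_ge : ρ ≤ S.eventProb ν A
  score_differentiable : ∀ l, 1 ≤ l → l ≤ L → Differentiable ℝ fun x => S.score x (S.t l)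
  score_fderiv_le : ∀ l, 1 ≤ l → l ≤ L → ∀ x, ‖fderiv ℝ (fun x' => S.score x' (S.t l)) x‖ ≤ G

/-- The coefficients of the means of the reverse steps are bounded by `B`. -/
def CoeffBounded (B : ℝ) : Prop :=
  ∀ l, 1 ≤ l → l ≤ L → |S.a l| ≤ B ∧ |S.b l| ≤ B

end DiffusionSampler

end

/-! The law `P^h` has density `h / P(ℰ)`, and Gaussian integration by parts over one reverse step
`X_k = μ(x) + σ Z` gives `∇ log h = σ⁻¹ (∇μ)ᵀ V / h` with `V = 𝔼[h(X_k) Z]`. The estimator has the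
same form with `V` and `h` replaced by the sample averages `V̂` and `ĥ`, so its error is governed by
`‖V̂ - V‖² + (ĥ - h)²` together with the bias of the truncation on `{h < η}`.

The entropy inequality `‖V‖² ≤ h² log (D / h) / c` bounds `V / h` up to a logarithm, and since `P^h`
carries the weight `h`, the truncation costs only about `η log (1 / η) / P(ℰ)`. For the sampling
error, the summands `(h(X_0) Z, h(X_0))` are square-exponentially integrable uniformly in `x`, hence
so is the error of their average at scale `1 / M`. Jensen under `P^h` followed by Markov over the
noises turns this into a bound of order `log (1 / δ) / M` on the error integrated over `x`, with no
union bound; dividing by `η²` still leaves a term smaller than the bias at `η = M^(-1/6)`. -/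

section SquareExponentialMoments

theorem exp_le_add_exp_sq (x : ℝ) : Real.exp x ≤ x + Real.exp (x ^ 2) := by
  have hsq := Real.add_one_le_exp (x ^ 2)
  rcases le_or_gt |x| 1 with hx | hx
  · have := (abs_le.1 (Real.abs_exp_sub_one_sub_id_le hx)).2
    linarith
  · rcases lt_abs.1 hx with hx | hx
    · have : Real.exp x ≤ Real.exp (x ^ 2) := Real.exp_le_exp.2 (by nlinarith)
      linarith
    · have : Real.exp x ≤ 1 := Real.exp_le_one_iff.2 (by linarith)
      nlinarith

theorem exp_mul_le_one_sub_add_mul_exp {s : ℝ} (hs₀ : 0 ≤ s) (hs₁ : s ≤ 1) (w : ℝ) :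
    Real.exp (s * w) ≤ 1 - s + s * Real.exp w := by
  simpa using
    convexOn_exp.2 (Set.mem_univ (0 : ℝ)) (Set.mem_univ w) (sub_nonneg.2 hs₁) hs₀ (by ring)

theorem mul_le_sq_div_add_mul_sq {c : ℝ} (hc : 0 < c) (x y : ℝ) :
    x * y ≤ y ^ 2 / (4 * c) + c * x ^ 2 := by
  have hsq : 0 ≤ (y - 2 * c * x) ^ 2 / (4 * c) := by positivity
  have hexpand : (y - 2 * c * x) ^ 2 / (4 * c) = y ^ 2 / (4 * c) + c * x ^ 2 - x * y := by
    field_simp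
    ring
  linarith

variable {Ω : Type*} [MeasurableSpace Ω] {P : Measure Ω} {E : Type*} [NormedAddCommGroup E]

theorem integrable_of_integrable_exp_sq [IsFiniteMeasure P] {Y : Ω → E}
    (hY : AEStronglyMeasurable Y P) {c : ℝ} (hc : 0 < c)
    (hexp : Integrable (fun ω => Real.exp (c * ‖Y ω‖ ^ 2)) P) : Integrable Y P := by
  refine ((integrable_const (1 / (4 * c))).add hexp).mono' hY (ae_of_all _ fun ω => ?_)
  have hyoung := mul_le_sq_div_add_mul_sq hc ‖Y ω‖ 1
  have := Real.add_one_le_exp (c * ‖Y ω‖ ^ 2)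
  simp only [Pi.add_apply]
  linarith

theorem one_le_integral_exp_sq [IsProbabilityMeasure P] {Y : Ω → E} {c : ℝ} (hc : 0 < c)
    (hexp : Integrable (fun ω => Real.exp (c * ‖Y ω‖ ^ 2)) P) :
    1 ≤ ∫ ω, Real.exp (c * ‖Y ω‖ ^ 2) ∂P := by
  simpa using
    integral_mono (integrable_const (1 : ℝ)) hexp fun ω => Real.one_le_exp (by positivity)

theorem exp_sq_norm_integral_le [NormedSpace ℝ E] [CompleteSpace E] [IsProbabilityMeasure P]
    {Y : Ω → E} (hY : AEStronglyMeasurable Y P) {c : ℝ} (hc : 0 < c)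
    (hexp : Integrable (fun ω => Real.exp (c * ‖Y ω‖ ^ 2)) P) :
    Real.exp (c * ‖∫ ω, Y ω ∂P‖ ^ 2) ≤ ∫ ω, Real.exp (c * ‖Y ω‖ ^ 2) ∂P := by
  have hnorm : ConvexOn ℝ Set.univ fun y : E => c * ‖y‖ ^ 2 :=
    (convexOn_univ_norm.pow (fun y _ => norm_nonneg y) 2).smul hc.le
  have hconvex : ConvexOn ℝ Set.univ fun y : E => Real.exp (c * ‖y‖ ^ 2) :=
    (convexOn_exp.subset (Set.subset_univ _)
      (Set.image_univ ▸ isPreconnected_range (by fun_prop)).convex).comp hnorm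
      (Real.exp_monotone.monotoneOn _)
  exact hconvex.map_integral_le (by fun_prop) isClosed_univ (ae_of_all _ fun _ => Set.mem_univ _)
    (integrable_of_integrable_exp_sq hY hc hexp) hexp

section Centring

variable [NormedSpace ℝ E] [CompleteSpace E] [IsProbabilityMeasure P] {Y : Ω → E} {c : ℝ}

theorem exp_sq_sub_integral_le (hY : AEStronglyMeasurable Y P) (hc : 0 < c)
    (hexp : Integrable (fun ω => Real.exp (c * ‖Y ω‖ ^ 2)) P) (ω : Ω) :
    Real.exp (c / 2 * ‖Y ω - ∫ ω', Y ω' ∂P‖ ^ 2)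
      ≤ (∫ ω', Real.exp (c * ‖Y ω'‖ ^ 2) ∂P) * Real.exp (c * ‖Y ω‖ ^ 2) := by
  refine le_trans ?_ (mul_le_mul_of_nonneg_right (exp_sq_norm_integral_le hY hc hexp)
    (Real.exp_pos _).le)
  rw [← Real.exp_add, Real.exp_le_exp]
  have htri := pow_le_pow_left₀ (norm_nonneg _) (norm_sub_le (Y ω) (∫ ω', Y ω' ∂P)) 2
  nlinarith [sq_nonneg (‖Y ω‖ - ‖∫ ω', Y ω' ∂P‖)]

theorem integrable_exp_sq_sub_integral (hY : AEStronglyMeasurable Y P) (hc : 0 < c)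
    (hexp : Integrable (fun ω => Real.exp (c * ‖Y ω‖ ^ 2)) P) :
    Integrable (fun ω => Real.exp (c / 2 * ‖Y ω - ∫ ω', Y ω' ∂P‖ ^ 2)) P := by
  refine (hexp.const_mul (∫ ω', Real.exp (c * ‖Y ω'‖ ^ 2) ∂P)).mono'
    (Real.continuous_exp.comp_aestronglyMeasurable
      (((hY.sub aestronglyMeasurable_const).norm.pow 2).const_mul _)) (ae_of_all _ fun ω => ?_)
  rw [Real.norm_eq_abs, Real.abs_exp]
  exact exp_sq_sub_integral_le hY hc hexp ω

theorem integral_exp_sq_sub_integral_le (hY : AEStronglyMeasurable Y P) (hc : 0 < c)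
    (hexp : Integrable (fun ω => Real.exp (c * ‖Y ω‖ ^ 2)) P) :
    ∫ ω, Real.exp (c / 2 * ‖Y ω - ∫ ω', Y ω' ∂P‖ ^ 2) ∂P
      ≤ (∫ ω, Real.exp (c * ‖Y ω‖ ^ 2) ∂P) ^ 2 := by
  rw [sq, ← integral_const_mul]
  exact integral_mono (integrable_exp_sq_sub_integral hY hc hexp) (hexp.const_mul _)
    (exp_sq_sub_integral_le hY hc hexp)

end Centring

end SquareExponentialMoments

section SubGaussian

open scoped RealInnerProductSpace

variable {Ω : Type*} [MeasurableSpace Ω] {P : Measure Ω} {E : Type*} [NormedAddCommGroup E]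
  [InnerProductSpace ℝ E]

theorem exp_inner_le_mul_exp_sq {c : ℝ} (hc : 0 < c) (y u : E) :
    Real.exp ⟪y, u⟫ ≤ Real.exp (‖u‖ ^ 2 / (4 * c)) * Real.exp (c * ‖y‖ ^ 2) := by
  rw [← Real.exp_add]
  exact Real.exp_le_exp.2 ((real_inner_le_norm y u).trans (mul_le_sq_div_add_mul_sq hc _ _))

theorem integrable_exp_inner {Y : Ω → E} (hY : AEStronglyMeasurable Y P) {c : ℝ} (hc : 0 < c)
    (hexp : Integrable (fun ω => Real.exp (c * ‖Y ω‖ ^ 2)) P) (u : E) :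
    Integrable (fun ω => Real.exp ⟪Y ω, u⟫) P := by
  refine (hexp.const_mul (Real.exp (‖u‖ ^ 2 / (4 * c)))).mono'
    (Real.continuous_exp.comp_aestronglyMeasurable
      (hY.inner aestronglyMeasurable_const)) (ae_of_all _ fun ω => ?_)
  rw [Real.norm_eq_abs, Real.abs_exp]
  exact exp_inner_le_mul_exp_sq hc _ _

theorem exp_inner_le_of_norm_sq_le {c : ℝ} (hc : 0 < c) (y : E) {u : E} (hu : ‖u‖ ^ 2 ≤ c) :
    Real.exp ⟪y, u⟫
      ≤ ⟪y, u⟫ + (1 - ‖u‖ ^ 2 / c + ‖u‖ ^ 2 / c * Real.exp (c * ‖y‖ ^ 2)) := by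
  have hinner : ⟪y, u⟫ ^ 2 ≤ ‖u‖ ^ 2 / c * (c * ‖y‖ ^ 2) := by
    have : ‖u‖ ^ 2 / c * (c * ‖y‖ ^ 2) = (‖y‖ * ‖u‖) ^ 2 := by field_simp
    rw [this]
    exact sq_le_sq' (neg_le_of_abs_le (abs_real_inner_le_norm _ _)) (real_inner_le_norm _ _)
  calc Real.exp ⟪y, u⟫ ≤ ⟪y, u⟫ + Real.exp (⟪y, u⟫ ^ 2) := exp_le_add_exp_sq _
    _ ≤ ⟪y, u⟫ + Real.exp (‖u‖ ^ 2 / c * (c * ‖y‖ ^ 2)) := by gcongr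
    _ ≤ _ := add_le_add_right
        (exp_mul_le_one_sub_add_mul_exp (by positivity) ((div_le_one hc).2 hu) _) _

variable [IsProbabilityMeasure P] {Y : Ω → E} {c : ℝ}

theorem integral_exp_inner_le_of_norm_sq_le [CompleteSpace E] (hY : AEStronglyMeasurable Y P)
    (hc : 0 < c) (hexp : Integrable (fun ω => Real.exp (c * ‖Y ω‖ ^ 2)) P)
    (hmean : ∫ ω, Y ω ∂P = 0) {u : E} (hu : ‖u‖ ^ 2 ≤ c) :
    ∫ ω, Real.exp ⟪Y ω, u⟫ ∂P
      ≤ Real.exp ((∫ ω, Real.exp (c * ‖Y ω‖ ^ 2) ∂P) / c * ‖u‖ ^ 2) := by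
  have hYint := integrable_of_integrable_exp_sq hY hc hexp
  have hinner : ∫ ω, ⟪Y ω, u⟫ ∂P = 0 := by
    simp_rw [real_inner_comm u]
    rw [integral_inner hYint u, hmean, inner_zero_right]
  have hscaled := hexp.const_mul (‖u‖ ^ 2 / c)
  have hbound : Integrable
      (fun ω => 1 - ‖u‖ ^ 2 / c + ‖u‖ ^ 2 / c * Real.exp (c * ‖Y ω‖ ^ 2)) P :=
    (integrable_const _).add hscaled
  calc ∫ ω, Real.exp ⟪Y ω, u⟫ ∂P
      ≤ ∫ ω, (⟪Y ω, u⟫ + (1 - ‖u‖ ^ 2 / c + ‖u‖ ^ 2 / c * Real.exp (c * ‖Y ω‖ ^ 2))) ∂P :=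
        integral_mono (integrable_exp_inner hY hc hexp u) ((hYint.inner_const u).add hbound)
          fun ω => exp_inner_le_of_norm_sq_le hc (Y ω) hu
    _ = 1 - ‖u‖ ^ 2 / c + ‖u‖ ^ 2 / c * ∫ ω, Real.exp (c * ‖Y ω‖ ^ 2) ∂P := by
        rw [integral_add (hYint.inner_const u) hbound, hinner,
          integral_add (integrable_const _) hscaled, integral_const_mul]
        simp
    _ ≤ (∫ ω, Real.exp (c * ‖Y ω‖ ^ 2) ∂P) / c * ‖u‖ ^ 2 + 1 := by
        have : 0 ≤ ‖u‖ ^ 2 / c := by positivity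
        linarith [div_mul_comm (∫ ω, Real.exp (c * ‖Y ω‖ ^ 2) ∂P) c (‖u‖ ^ 2)]
    _ ≤ _ := Real.add_one_le_exp _

theorem integral_exp_inner_le_of_le_norm_sq (hY : AEStronglyMeasurable Y P) (hc : 0 < c)
    (hexp : Integrable (fun ω => Real.exp (c * ‖Y ω‖ ^ 2)) P) {u : E} (hu : c ≤ ‖u‖ ^ 2) :
    ∫ ω, Real.exp ⟪Y ω, u⟫ ∂P
      ≤ Real.exp ((∫ ω, Real.exp (c * ‖Y ω‖ ^ 2) ∂P) / c * ‖u‖ ^ 2) := by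
  have hD := one_le_integral_exp_sq hc hexp
  set D := ∫ ω, Real.exp (c * ‖Y ω‖ ^ 2) ∂P
  calc ∫ ω, Real.exp ⟪Y ω, u⟫ ∂P
      ≤ ∫ ω, Real.exp (‖u‖ ^ 2 / (4 * c)) * Real.exp (c * ‖Y ω‖ ^ 2) ∂P :=
        integral_mono (integrable_exp_inner hY hc hexp u) (hexp.const_mul _)
          fun ω => exp_inner_le_mul_exp_sq hc _ _
    _ = Real.exp (‖u‖ ^ 2 / (4 * c)) * D := integral_const_mul _ _
    _ ≤ Real.exp (‖u‖ ^ 2 / c) * Real.exp (D - 1) := by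
        gcongr
        · linarith
        · linarith [Real.add_one_le_exp (D - 1)]
    _ ≤ Real.exp (D / c * ‖u‖ ^ 2) := by
        rw [← Real.exp_add, Real.exp_le_exp]
        have hu' : 1 ≤ ‖u‖ ^ 2 / c := (one_le_div hc).2 hu
        have hfactor : D / c * ‖u‖ ^ 2 = D * (‖u‖ ^ 2 / c) := by ring
        nlinarith

theorem integral_exp_inner_le [CompleteSpace E] (hY : AEStronglyMeasurable Y P) (hc : 0 < c)
    (hexp : Integrable (fun ω => Real.exp (c * ‖Y ω‖ ^ 2)) P) (hmean : ∫ ω, Y ω ∂P = 0) (u : E) :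
    ∫ ω, Real.exp ⟪Y ω, u⟫ ∂P
      ≤ Real.exp ((∫ ω, Real.exp (c * ‖Y ω‖ ^ 2) ∂P) / c * ‖u‖ ^ 2) :=
  (le_total (‖u‖ ^ 2) c).elim (integral_exp_inner_le_of_norm_sq_le hY hc hexp hmean)
    (integral_exp_inner_le_of_le_norm_sq hY hc hexp)

theorem lintegral_exp_inner_sum_le [CompleteSpace E] (hY : AEStronglyMeasurable Y P) (hc : 0 < c)
    (hexp : Integrable (fun ω => Real.exp (c * ‖Y ω‖ ^ 2)) P) (hmean : ∫ ω, Y ω ∂P = 0)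
    (ι : Type*) [Fintype ι] (u : E) :
    ∫⁻ z, ENNReal.ofReal (Real.exp ⟪∑ i, Y (z i), u⟫) ∂(Measure.pi fun _ : ι => P)
      ≤ ENNReal.ofReal (Real.exp
          (Fintype.card ι * ((∫ ω, Real.exp (c * ‖Y ω‖ ^ 2) ∂P) / c * ‖u‖ ^ 2))) := by
  have hint := Integrable.fintype_prod (ι := ι) (μ := fun _ => P)
    (f := fun _ ω => Real.exp ⟪Y ω, u⟫) fun _ => integrable_exp_inner hY hc hexp u
  simp_rw [sum_inner, Real.exp_sum]
  rw [← ofReal_integral_eq_lintegral_ofReal hint (ae_of_all _ fun z => by positivity),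
    integral_fintype_prod_eq_pow (fun ω => Real.exp ⟪Y ω, u⟫), Real.exp_nat_mul]
  exact ENNReal.ofReal_le_ofReal (pow_le_pow_left₀ (integral_nonneg fun _ => by positivity)
    (integral_exp_inner_le hY hc hexp hmean u) _)

end SubGaussian

section Concentration

open scoped RealInnerProductSpace

variable {E : Type*} [NormedAddCommGroup E] [InnerProductSpace ℝ E] [FiniteDimensional ℝ E]
  [MeasurableSpace E] [BorelSpace E]

theorem integrable_exp_inner_stdGaussian (v : E) :
    Integrable (fun z => Real.exp ⟪v, z⟫) (stdGaussian E) := by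
  obtain ⟨c, hc, hexp⟩ := IsGaussian.exists_integrable_exp_sq (stdGaussian E)
  simp_rw [real_inner_comm _ v]
  exact integrable_exp_inner (Y := id) aestronglyMeasurable_id hc hexp v

theorem integral_exp_inner_stdGaussian (v : E) :
    ∫ z, Real.exp ⟪v, z⟫ ∂(stdGaussian E) = Real.exp (‖v‖ ^ 2 / 2) := by
  have h := IsGaussian.map_eq_gaussianReal (μ := stdGaussian E) (innerSL ℝ v)
  rw [variance_dual_stdGaussian, integral_strongDual_stdGaussian] at h
  simpa [mgf] using mgf_gaussianReal h 1

theorem lintegral_exp_mul_inner_stdGaussian (v : E) (τ : ℝ) :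
    ∫⁻ u, ENNReal.ofReal (Real.exp ⟪v, τ • u⟫) ∂(stdGaussian E)
      = ENNReal.ofReal (Real.exp (τ ^ 2 * ‖v‖ ^ 2 / 2)) := by
  simp_rw [real_inner_smul_right, ← real_inner_smul_left]
  rw [← ofReal_integral_eq_lintegral_ofReal (integrable_exp_inner_stdGaussian _)
    (ae_of_all _ fun z => by positivity), integral_exp_inner_stdGaussian, norm_smul, mul_pow,
    Real.norm_eq_abs, sq_abs]

variable {Ω : Type*} [MeasurableSpace Ω] {P : Measure Ω} [IsProbabilityMeasure P] {Y : Ω → E}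
  {a c : ℝ} {ι : Type*} [Fintype ι] [Nonempty ι]

/-- `exp (τ² ‖s‖² / 2)` is the Gaussian average of `exp ⟪s, τ u⟫` over `u`, so the
square-exponential moment of the sum `s` reduces to its moment generating function. -/
theorem lintegral_exp_sq_sum_le (hY : Measurable Y) (hc : 0 < c)
    (hexp : Integrable (fun ω => Real.exp (c * ‖Y ω‖ ^ 2)) P) (hmean : ∫ ω, Y ω ∂P = 0)
    (ha : 0 < a) (hgauss : Integrable (fun u => Real.exp (a * ‖u‖ ^ 2)) (stdGaussian E))
    {D : ℝ} (hD : ∫ ω, Real.exp (c * ‖Y ω‖ ^ 2) ∂P ≤ D) :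
    ∫⁻ z, ENNReal.ofReal (Real.exp (a * c / (2 * D) * (‖∑ i, Y (z i)‖ ^ 2 / Fintype.card ι)))
        ∂(Measure.pi fun _ : ι => P)
      ≤ ENNReal.ofReal (∫ u, Real.exp (a * ‖u‖ ^ 2) ∂(stdGaussian E)) := by
  have hDpos : 0 < D := zero_lt_one.trans_le ((one_le_integral_exp_sq hc hexp).trans hD)
  have : (0 : ℝ) < Fintype.card ι := by exact_mod_cast Fintype.card_pos
  set τ := √(a * c / (D * Fintype.card ι))
  have hτ : τ ^ 2 = a * c / (D * Fintype.card ι) := Real.sq_sqrt (by positivity)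
  have hmeas : Measurable fun p : (ι → Ω) × E =>
      ENNReal.ofReal (Real.exp ⟪∑ i, Y (p.1 i), τ • p.2⟫) := by fun_prop
  calc ∫⁻ z, ENNReal.ofReal (Real.exp (a * c / (2 * D) * (‖∑ i, Y (z i)‖ ^ 2 / Fintype.card ι)))
        ∂(Measure.pi fun _ : ι => P)
      = ∫⁻ z, ∫⁻ u, ENNReal.ofReal (Real.exp ⟪∑ i, Y (z i), τ • u⟫) ∂(stdGaussian E)
        ∂(Measure.pi fun _ : ι => P) := by
        refine lintegral_congr fun z => ?_
        rw [lintegral_exp_mul_inner_stdGaussian, hτ]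
        congr 2
        field_simp
    _ = ∫⁻ u, ∫⁻ z, ENNReal.ofReal (Real.exp ⟪∑ i, Y (z i), τ • u⟫)
        ∂(Measure.pi fun _ : ι => P) ∂(stdGaussian E) :=
        lintegral_lintegral_swap hmeas.aemeasurable
    _ ≤ ∫⁻ u, ENNReal.ofReal (Real.exp (a * ‖u‖ ^ 2)) ∂(stdGaussian E) := by
        refine lintegral_mono fun u =>
          (lintegral_exp_inner_sum_le hY.aestronglyMeasurable hc hexp hmean ι _).trans
            (ENNReal.ofReal_le_ofReal (Real.exp_le_exp.2 ?_))
        rw [norm_smul, mul_pow, Real.norm_eq_abs, sq_abs, hτ]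
        calc _ ≤ Fintype.card ι * (D / c * (a * c / (D * Fintype.card ι) * ‖u‖ ^ 2)) := by gcongr
          _ = a * ‖u‖ ^ 2 := by field_simp
    _ = ENNReal.ofReal (∫ u, Real.exp (a * ‖u‖ ^ 2) ∂(stdGaussian E)) :=
        (ofReal_integral_eq_lintegral_ofReal hgauss (ae_of_all _ fun z => by positivity)).symm

theorem lintegral_exp_sq_average_sub_integral_le (hY : Measurable Y) (hc : 0 < c)
    (hexp : Integrable (fun ω => Real.exp (c * ‖Y ω‖ ^ 2)) P)
    (ha : 0 < a) (hgauss : Integrable (fun u => Real.exp (a * ‖u‖ ^ 2)) (stdGaussian E))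
    {D : ℝ} (hD : ∫ ω, Real.exp (c * ‖Y ω‖ ^ 2) ∂P ≤ D) :
    ∫⁻ z, ENNReal.ofReal (Real.exp (a * c / (4 * D ^ 2) * Fintype.card ι *
          ‖(Fintype.card ι : ℝ)⁻¹ • ∑ i, Y (z i) - ∫ ω, Y ω ∂P‖ ^ 2))
        ∂(Measure.pi fun _ : ι => P)
      ≤ ENNReal.ofReal (∫ u, Real.exp (a * ‖u‖ ^ 2) ∂(stdGaussian E)) := by
  have hYint := integrable_of_integrable_exp_sq hY.aestronglyMeasurable hc hexp
  have hD' : ∫ ω, Real.exp (c / 2 * ‖Y ω - ∫ ω', Y ω' ∂P‖ ^ 2) ∂P ≤ D ^ 2 :=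
    (integral_exp_sq_sub_integral_le hY.aestronglyMeasurable hc hexp).trans
      (pow_le_pow_left₀ (integral_nonneg fun _ => by positivity) hD 2)
  refine le_trans (le_of_eq (lintegral_congr fun z => ?_))
    (lintegral_exp_sq_sum_le (ι := ι) (hY.sub_const (∫ ω, Y ω ∂P)) (half_pos hc)
      (integrable_exp_sq_sub_integral hY.aestronglyMeasurable hc hexp)
      (by rw [integral_sub hYint (integrable_const _)]; simp) ha hgauss hD')
  have hcard : (0 : ℝ) < Fintype.card ι := by exact_mod_cast Fintype.card_pos
  have havg : (Fintype.card ι : ℝ)⁻¹ • ∑ i, Y (z i) - ∫ ω, Y ω ∂P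
      = (Fintype.card ι : ℝ)⁻¹ • ∑ i, (Y (z i) - ∫ ω, Y ω ∂P) := by
    rw [Finset.sum_sub_distrib, Finset.sum_const, Finset.card_univ, ← Nat.cast_smul_eq_nsmul ℝ,
      smul_sub, inv_smul_smul₀ hcard.ne']
  rw [havg, norm_smul, Real.norm_of_nonneg (by positivity)]
  congr 2
  field_simp
  ring

end Concentration

section Chernoff

variable {X Ω : Type*} [MeasurableSpace X] [MeasurableSpace Ω]

theorem lintegral_ofReal_le_log {T : Measure X} [IsProbabilityMeasure T] {W : X → ℝ}
    (hW : Measurable W) (hW₀ : ∀ x, 0 ≤ W x) {r : ℝ} (hr : 0 < r)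
    (hexp : ∫⁻ x, ENNReal.ofReal (Real.exp (W x)) ∂T ≤ ENNReal.ofReal r) :
    ∫⁻ x, ENNReal.ofReal (W x) ∂T ≤ ENNReal.ofReal (Real.log r) := by
  have hexpint : Integrable (fun x => Real.exp (W x)) T := by
    refine ⟨(Real.measurable_exp.comp hW).aestronglyMeasurable, ?_⟩
    rw [hasFiniteIntegral_iff_ofReal (ae_of_all _ fun x => by positivity)]
    exact hexp.trans_lt ENNReal.ofReal_lt_top
  have hWint : Integrable W T := by
    refine hexpint.mono' hW.aestronglyMeasurable (ae_of_all _ fun x => ?_)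
    rw [Real.norm_of_nonneg (hW₀ x)]
    linarith [Real.add_one_le_exp (W x)]
  rw [← ofReal_integral_eq_lintegral_ofReal hexpint (ae_of_all _ fun x => by positivity),
    ENNReal.ofReal_le_ofReal_iff hr.le] at hexp
  rw [← ofReal_integral_eq_lintegral_ofReal hWint (ae_of_all _ hW₀)]
  refine ENNReal.ofReal_le_ofReal ((Real.le_log_iff_exp_le hr).2 (le_trans ?_ hexp))
  exact convexOn_exp.map_integral_le Real.continuous_exp.continuousOn isClosed_univ
    (ae_of_all _ fun _ => Set.mem_univ _) hWint hexpint

theorem one_sub_le_measure_le_div {P : Measure Ω} [IsProbabilityMeasure P] {F : Ω → ENNReal}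
    (hF : Measurable F) {D δ : ℝ} (hD : 0 < D) (hδ : 0 < δ)
    (hmean : ∫⁻ ω, F ω ∂P ≤ ENNReal.ofReal D) :
    ENNReal.ofReal (1 - δ) ≤ P {ω | F ω ≤ ENNReal.ofReal (D / δ)} := by
  have hmarkov : P {ω | ENNReal.ofReal (D / δ) ≤ F ω} ≤ ENNReal.ofReal δ := by
    refine (meas_ge_le_lintegral_div hF.aemeasurable
      (ENNReal.ofReal_pos.2 (by positivity)).ne' ENNReal.ofReal_ne_top).trans
      ((ENNReal.div_le_div_right hmean _).trans_eq ?_)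
    rw [← ENNReal.ofReal_div_of_pos (by positivity), div_div_cancel₀ hD.ne']
  calc ENNReal.ofReal (1 - δ) = 1 - ENNReal.ofReal δ := by
        rw [ENNReal.ofReal_sub _ hδ.le, ENNReal.ofReal_one]
    _ ≤ 1 - P {ω | ENNReal.ofReal (D / δ) ≤ F ω} := tsub_le_tsub_left hmarkov _
    _ = P {ω | ENNReal.ofReal (D / δ) ≤ F ω}ᶜ :=
        (prob_compl_eq_one_sub (measurableSet_le measurable_const hF)).symm
    _ ≤ _ := measure_mono fun ω (hω : ¬ENNReal.ofReal (D / δ) ≤ F ω) => (not_le.1 hω).le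

theorem one_sub_le_measure_lintegral_le_log {P : Measure Ω} [IsProbabilityMeasure P]
    {T : Measure X} [IsProbabilityMeasure T] {W : X → Ω → ℝ}
    (hW : Measurable (Function.uncurry W)) (hW₀ : ∀ x ω, 0 ≤ W x ω) {D δ : ℝ} (hD : 0 < D)
    (hδ : 0 < δ)
    (hexp : ∀ x, ∫⁻ ω, ENNReal.ofReal (Real.exp (W x ω)) ∂P ≤ ENNReal.ofReal D) :
    ENNReal.ofReal (1 - δ) ≤
      P {ω | ∫⁻ x, ENNReal.ofReal (W x ω) ∂T ≤ ENNReal.ofReal (Real.log (D / δ))} := by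
  have hmeas : Measurable (Function.uncurry fun ω x => ENNReal.ofReal (Real.exp (W x ω))) :=
    (Real.measurable_exp.comp (hW.comp measurable_swap)).ennreal_ofReal
  have hmean : ∫⁻ ω, ∫⁻ x, ENNReal.ofReal (Real.exp (W x ω)) ∂T ∂P ≤ ENNReal.ofReal D := by
    rw [lintegral_lintegral_swap hmeas.aemeasurable]
    exact (lintegral_mono hexp).trans_eq (by simp)
  refine (one_sub_le_measure_le_div hmeas.lintegral_prod_right' hD hδ hmean).trans
    (measure_mono fun ω hω => lintegral_ofReal_le_log ?_ (fun x => hW₀ x ω) (by positivity) hω)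
  exact hW.comp (measurable_id.prodMk measurable_const)

end Chernoff

section GaussianSmoothing

open scoped RealInnerProductSpace

variable {E : Type*} [NormedAddCommGroup E] [InnerProductSpace ℝ E]

theorem hasFDerivAt_exp_inner_sub_half_sq (v z : E) :
    HasFDerivAt (fun v => Real.exp (⟪v, z⟫ - ‖v‖ ^ 2 / 2))
      (Real.exp (⟪v, z⟫ - ‖v‖ ^ 2 / 2) • innerSL ℝ (z - v)) v := by
  have hinner : HasFDerivAt (fun v : E => ⟪v, z⟫) (innerSL ℝ z) v := by
    simp_rw [real_inner_comm z]
    exact (innerSL ℝ z).hasFDerivAt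
  have hsq := (hasStrictFDerivAt_norm_sq v).hasFDerivAt.const_mul (1 / 2 : ℝ)
  simp_rw [div_eq_inv_mul, ← one_div]
  refine (hinner.sub hsq).exp.congr_fderiv ?_
  ext w
  simp

variable [FiniteDimensional ℝ E] [MeasurableSpace E] [BorelSpace E]

theorem ext_of_integral_exp_inner {μ ν : Measure E} [IsProbabilityMeasure μ] [IsFiniteMeasure ν]
    (hμ : ∀ u, Integrable (fun z => Real.exp ⟪u, z⟫) μ)
    (h : ∀ u, ∫ z, Real.exp ⟪u, z⟫ ∂μ = ∫ z, Real.exp ⟪u, z⟫ ∂ν) : μ = ν := by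
  refine Measure.ext_of_charFun (funext fun u => ?_)
  have hset : integrableExpSet (fun z => ⟪u, z⟫) μ = Set.univ :=
    Set.eq_univ_of_forall fun t => by
      simpa only [integrableExpSet, Set.mem_ofPred_eq, real_inner_smul_left] using hμ (t • u)
  have hmgf : mgf (fun z => ⟪u, z⟫) μ = mgf (fun z => ⟪u, z⟫) ν := funext fun t => by
    simpa only [mgf, real_inner_smul_left] using h (t • u)
  have hcomplex := eqOn_complexMGF_of_mgf hmgf (show Complex.I ∈ _ by simp [hset])
  simpa only [complexMGF, charFun_apply, real_inner_comm u, mul_comm Complex.I] using hcomplex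

theorem map_add_const_stdGaussian (v : E) :
    (stdGaussian E).map (fun z => z + v) = (stdGaussian E).tilted fun z => ⟪v, z⟫ := by
  have : IsProbabilityMeasure ((stdGaussian E).map fun z => z + v) :=
    Measure.isProbabilityMeasure_map (by fun_prop)
  refine ext_of_integral_exp_inner (fun u => ?_) fun u => ?_
  · refine (integrable_map_measure (by fun_prop) (by fun_prop)).2 ?_
    simp only [Function.comp_def, inner_add_right, Real.exp_add]
    exact (integrable_exp_inner_stdGaussian u).mul_const _
  · rw [integral_map (by fun_prop) (by fun_prop), integral_tilted]
    simp_rw [smul_eq_mul, div_mul_eq_mul_div, ← Real.exp_add, ← inner_add_left]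
    simp_rw [inner_add_right, Real.exp_add]
    rw [integral_mul_const, integral_div]
    simp_rw [integral_exp_inner_stdGaussian]
    rw [← Real.exp_add, ← Real.exp_sub, norm_add_sq_real, real_inner_comm v u]
    ring_nf

theorem integral_add_const_stdGaussian {F : Type*} [NormedAddCommGroup F] [NormedSpace ℝ F]
    {g : E → F} (hg : StronglyMeasurable g) (v : E) :
    ∫ z, g (z + v) ∂(stdGaussian E)
      = ∫ z, Real.exp (⟪v, z⟫ - ‖v‖ ^ 2 / 2) • g z ∂(stdGaussian E) := by
  rw [← integral_map (φ := fun z => z + v) (by fun_prop) hg.aestronglyMeasurable,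
    map_add_const_stdGaussian, integral_tilted, integral_exp_inner_stdGaussian]
  simp_rw [← Real.exp_sub]

variable (E) in
theorem integrable_exp_mul_norm_stdGaussian (r : ℝ) :
    Integrable (fun z => Real.exp (r * ‖z‖)) (stdGaussian E) := by
  obtain ⟨c, hc, hexp⟩ := IsGaussian.exists_integrable_exp_sq (stdGaussian E)
  refine (hexp.const_mul (Real.exp (r ^ 2 / (4 * c)))).mono' (by fun_prop)
    (ae_of_all _ fun z => ?_)
  rw [Real.norm_eq_abs, Real.abs_exp, ← Real.exp_add, mul_comm r]
  exact Real.exp_le_exp.2 (mul_le_sq_div_add_mul_sq hc _ _)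

variable {g : E → ℝ} {C : ℝ}

theorem integrable_smul_id_stdGaussian (hg : Measurable g) (hgC : ∀ z, |g z| ≤ C) :
    Integrable (fun z => g z • z) (stdGaussian E) :=
  (IsGaussian.integrable_id (μ := stdGaussian E)).bdd_smul C hg.aestronglyMeasurable
    (ae_of_all _ hgC)

theorem hasFDerivAt_integral_exp_inner_mul_stdGaussian (hg : Measurable g)
    (hgC : ∀ z, |g z| ≤ C) :
    HasFDerivAt (fun v => ∫ z, Real.exp (⟪v, z⟫ - ‖v‖ ^ 2 / 2) * g z ∂(stdGaussian E))
      (innerSL ℝ (∫ z, g z • z ∂(stdGaussian E))) 0 := by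
  have hint := integrable_smul_id_stdGaussian hg hgC
  have hderiv_zero : ∀ z : E,
      g z • (Real.exp (⟪(0 : E), z⟫ - ‖(0 : E)‖ ^ 2 / 2) • innerSL ℝ (z - 0))
        = innerSL ℝ (g z • z) := fun z => by simp
  have hderiv := hasFDerivAt_integral_of_dominated_of_fderiv_le (𝕜 := ℝ) (μ := stdGaussian E)
    (F := fun v z => Real.exp (⟪v, z⟫ - ‖v‖ ^ 2 / 2) * g z)
    (F' := fun v z => g z • (Real.exp (⟪v, z⟫ - ‖v‖ ^ 2 / 2) • innerSL ℝ (z - v)))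
    (bound := fun z => C * Real.exp (2 * ‖z‖)) (x₀ := (0 : E)) (Metric.ball_mem_nhds 0 one_pos)
    (Filter.Eventually.of_forall fun v => by fun_prop) ?_ ?_ ?_
    ((integrable_exp_mul_norm_stdGaussian E 2).const_mul C) ?_
  · simp_rw [hderiv_zero] at hderiv
    rwa [(innerSL ℝ).integral_comp_comm hint] at hderiv
  · refine (integrable_const C).mono' (by fun_prop) (ae_of_all _ fun z => ?_)
    simpa using hgC z
  · simp_rw [hderiv_zero]
    exact (innerSL ℝ).continuous.comp_aestronglyMeasurable hint.1
  · refine ae_of_all _ fun z v hv => ?_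
    have hv₁ : ‖v‖ ≤ 1 := by simpa using (Metric.mem_ball.1 hv).le
    rw [norm_smul, norm_smul, innerSL_apply_norm, Real.norm_eq_abs, Real.norm_eq_abs,
      Real.abs_exp, two_mul, Real.exp_add]
    gcongr
    · exact (abs_nonneg _).trans (hgC 0)
    · exact hgC z
    · nlinarith [real_inner_le_norm v z, norm_nonneg z]
    · linarith [norm_sub_le z v, Real.add_one_le_exp ‖z‖]
  · exact ae_of_all _ fun z v _ => by
      simpa only [mul_comm (g z)] using (hasFDerivAt_exp_inner_sub_half_sq v z).mul_const (g z)

theorem hasFDerivAt_integral_add_smul_stdGaussian (hg : Measurable g) (hgC : ∀ z, |g z| ≤ C)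
    {σ : ℝ} (hσ : σ ≠ 0) (m : E) :
    HasFDerivAt (fun m => ∫ z, g (m + σ • z) ∂(stdGaussian E))
      (σ⁻¹ • innerSL ℝ (∫ z, g (m + σ • z) • z ∂(stdGaussian E))) m := by
  have hg' : Measurable fun z : E => g (m + σ • z) := by fun_prop
  have hshift : HasFDerivAt (fun m' : E => σ⁻¹ • (m' - m)) (σ⁻¹ • ContinuousLinearMap.id ℝ E) m :=
    ((hasFDerivAt_id m).sub_const m).const_smul σ⁻¹
  have hweighted : HasFDerivAt (fun v => ∫ z, Real.exp (⟪v, z⟫ - ‖v‖ ^ 2 / 2) * g (m + σ • z)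
      ∂(stdGaussian E)) (innerSL ℝ (∫ z, g (m + σ • z) • z ∂(stdGaussian E)))
      (σ⁻¹ • (m - m)) := by
    rw [sub_self, smul_zero]
    exact hasFDerivAt_integral_exp_inner_mul_stdGaussian hg' fun z => hgC _
  have hcomp : (fun m => ∫ z, g (m + σ • z) ∂(stdGaussian E)) = fun m' =>
      ∫ z, Real.exp (⟪σ⁻¹ • (m' - m), z⟫ - ‖σ⁻¹ • (m' - m)‖ ^ 2 / 2) * g (m + σ • z)
        ∂(stdGaussian E) := by
    funext m'
    refine Eq.trans ?_ (integral_add_const_stdGaussian hg'.stronglyMeasurable _)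
    congr 1 with z
    rw [smul_add, smul_inv_smul₀ hσ]
    congr 1
    abel
  rw [hcomp]
  refine (hweighted.comp m hshift).congr_fderiv ?_
  ext w
  simp

end GaussianSmoothing

section NoiseLaw

instance isProbabilityMeasure_noiseLaw (d l : ℕ) : IsProbabilityMeasure (noiseLaw d l) := by
  unfold noiseLaw
  infer_instance

instance isProbabilityMeasure_mcLaw (d l M : ℕ) : IsProbabilityMeasure (mcLaw d l M) := by
  unfold mcLaw
  infer_instance

@[fun_prop]
theorem measurable_finInit {α : Type*} [MeasurableSpace α] (l : ℕ) :
    Measurable fun z : Fin (l + 1) → α => (Fin.init z : Fin l → α) :=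
  measurable_pi_lambda _ fun i => measurable_pi_apply i.castSucc

theorem measurePreserving_last_init (d l : ℕ) :
    MeasurePreserving
      (fun z : Fin (l + 1) → Vec d => (z (Fin.last l), (Fin.init z : Fin l → Vec d)))
      (noiseLaw d (l + 1)) ((stdGaussian (Vec d)).prod (noiseLaw d l)) := by
  convert measurePreserving_piFinSuccAbove (fun _ : Fin (l + 1) => stdGaussian (Vec d))
    (Fin.last l) using 2
  · simp [MeasurableEquiv.piFinSuccAbove, Fin.insertNthEquiv]
  all_goals rfl

theorem measurePreserving_last (d l : ℕ) :
    MeasurePreserving (fun z : Fin (l + 1) → Vec d => z (Fin.last l))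
      (noiseLaw d (l + 1)) (stdGaussian (Vec d)) :=
  measurePreserving_eval (fun _ : Fin (l + 1) => stdGaussian (Vec d)) (Fin.last l)

end NoiseLaw

theorem map_fst_cond_prod {α β : Type*} [MeasurableSpace α] [MeasurableSpace β] {μ : Measure α}
    {ν : Measure β} [SFinite ν] {s : Set (α × β)} (hs : MeasurableSet s) :
    (cond (μ.prod ν) s).map Prod.fst
      = ((μ.prod ν) s)⁻¹ • μ.withDensity fun x => ν (Prod.mk x ⁻¹' s) := by
  ext t ht
  have hsection : ∀ x, ν (Prod.mk x ⁻¹' (s ∩ Prod.fst ⁻¹' t))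
      = t.indicator (fun x => ν (Prod.mk x ⁻¹' s)) x := fun x => by
    by_cases hx : x ∈ t <;> simp [Set.preimage_inter, Set.preimage_preimage, hx]
  rw [Measure.map_apply measurable_fst ht, cond_apply hs, Measure.smul_apply, smul_eq_mul,
    withDensity_apply _ ht, Measure.prod_apply (hs.inter (measurable_fst ht)),
    ← lintegral_indicator ht]
  simp_rw [hsection]

namespace DiffusionSampler

variable {d L : ℕ} {S : DiffusionSampler d L}

variable (S) in
/-- The score network is measurable in space at every grid time `t_1, …, t_L`; this makes the
reverse chain a Markov chain. -/
def MeasurableScore : Prop := ∀ l, 1 ≤ l → l ≤ L → Measurable fun x => S.score x (S.t l)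

theorem MeasurableScore.step (hS : S.MeasurableScore) {l : ℕ} (hl : 1 ≤ l) (hlL : l ≤ L) :
    Measurable fun p : Vec d × Vec d => S.step l p.1 p.2 := by
  have := hS l hl hlL
  unfold DiffusionSampler.step mean
  fun_prop

theorem MeasurableScore.rollout (hS : S.MeasurableScore) {l : ℕ} (hl : l ≤ L) :
    Measurable fun p : Vec d × (Fin l → Vec d) => S.rollout l p.1 p.2 := by
  induction l with
  | zero => exact measurable_fst
  | succ l ih =>
    have hstep := hS.step (l := l + 1) (by omega) hl
    exact (ih (by omega)).comp ((hstep.comp (by fun_prop : Measurable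
      fun p : Vec d × (Fin (l + 1) → Vec d) => (p.1, p.2 (Fin.last l)))).prodMk (by fun_prop))

theorem MeasurableScore.isProbabilityMeasure_lawAfter (hS : S.MeasurableScore) {n : ℕ}
    (hn : n ≤ L) : IsProbabilityMeasure (S.lawAfter n) := by
  induction n with
  | zero =>
    unfold lawAfter
    infer_instance
  | succ n ih =>
    have := ih (by omega)
    exact Measure.isProbabilityMeasure_map (hS.step (by omega) (by omega)).aemeasurable

theorem MeasurableScore.isProbabilityMeasure_marginal (hS : S.MeasurableScore) (l : ℕ) :
    IsProbabilityMeasure (S.marginal l) :=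
  hS.isProbabilityMeasure_lawAfter (Nat.sub_le L l)

theorem map_step_marginal_succ {l : ℕ} (hl : l + 1 ≤ L) :
    ((S.marginal (l + 1)).prod (stdGaussian (Vec d))).map (fun p => S.step (l + 1) p.1 p.2)
      = S.marginal l := by
  have hsub : L - l = (L - (l + 1)) + 1 := by omega
  have hstep : L - (L - (l + 1)) = l + 1 := by omega
  rw [marginal, marginal, hsub, lawAfter, hstep]

theorem map_rollout_marginal (hS : S.MeasurableScore) {l : ℕ} (hl : l ≤ L) :
    ((S.marginal l).prod (noiseLaw d l)).map (fun p => S.rollout l p.1 p.2) = S.marginal 0 := by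
  induction l with
  | zero =>
    change ((S.marginal 0).prod (noiseLaw d 0)).map Prod.fst = _
    simp
  | succ l ih =>
    have := hS.isProbabilityMeasure_marginal (l + 1)
    have := hS.isProbabilityMeasure_marginal l
    have hstep : MeasurePreserving (fun p : Vec d × Vec d => S.step (l + 1) p.1 p.2)
        ((S.marginal (l + 1)).prod (stdGaussian (Vec d))) (S.marginal l) :=
      ⟨hS.step (by omega) hl, map_step_marginal_succ hl⟩
    have hrollout : MeasurePreserving (fun p : Vec d × (Fin l → Vec d) => S.rollout l p.1 p.2)
        ((S.marginal l).prod (noiseLaw d l)) (S.marginal 0) :=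
      ⟨hS.rollout (by omega), ih (by omega)⟩
    exact (hrollout.comp ((hstep.prod (MeasurePreserving.id _)).comp
      ((measurePreserving_prodAssoc _ _ _).symm.comp
        ((MeasurePreserving.id _).prod (measurePreserving_last_init d l))))).map_eq

section DoobH

variable {𝒰 : Type*} [MeasurableSpace 𝒰] {ν : Measure 𝒰} {A : Set (Vec d × 𝒰)}

theorem doobH_nonneg (l : ℕ) (x : Vec d) : 0 ≤ S.doobH ν A l x := measureReal_nonneg

variable [IsProbabilityMeasure ν]

theorem doobH_le_one (l : ℕ) (x : Vec d) : S.doobH ν A l x ≤ 1 := measureReal_le_one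

theorem abs_doobH_le_one (l : ℕ) (x : Vec d) : |S.doobH ν A l x| ≤ 1 :=
  abs_le.2 ⟨by linarith [S.doobH_nonneg (ν := ν) (A := A) l x], doobH_le_one l x⟩

theorem doobH_zero (x : Vec d) : S.doobH ν A 0 x = ν.real (Prod.mk x ⁻¹' A) := by
  have hset : {p : (Fin 0 → Vec d) × 𝒰 | (S.rollout 0 x p.1, p.2) ∈ A}
      = Set.univ ×ˢ (Prod.mk x ⁻¹' A) := by
    ext p
    simp [rollout]
  rw [doobH, hset, measureReal_prod_prod]
  simp

theorem measurable_doobH_zero (hA : MeasurableSet A) : Measurable (S.doobH ν A 0) := by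
  rw [show S.doobH ν A 0 = fun x => ν.real (Prod.mk x ⁻¹' A) from funext doobH_zero]
  exact (measurable_measure_prodMk_left hA).ennreal_toReal

omit [IsProbabilityMeasure ν] in
theorem measurableSet_rollout_mem (hA : MeasurableSet A) (hS : S.MeasurableScore) {l : ℕ}
    (hl : l ≤ L) :
    MeasurableSet {p : Vec d × ((Fin l → Vec d) × 𝒰) | (S.rollout l p.1 p.2.1, p.2.2) ∈ A} :=
  (((hS.rollout hl).comp (by fun_prop : Measurable
    fun p : Vec d × ((Fin l → Vec d) × 𝒰) => (p.1, p.2.1))).prodMk (by fun_prop)) hA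

theorem measurable_doobH (hA : MeasurableSet A) (hS : S.MeasurableScore) {l : ℕ} (hl : l ≤ L) :
    Measurable (S.doobH ν A l) :=
  (measurable_measure_prodMk_left (measurableSet_rollout_mem hA hS hl)).ennreal_toReal

theorem doobH_eq_integral (hA : MeasurableSet A) (hS : S.MeasurableScore) {l : ℕ} (hl : l ≤ L)
    (x : Vec d) :
    S.doobH ν A l x = ∫ z, S.doobH ν A 0 (S.rollout l x z) ∂(noiseLaw d l) := by
  have hsection : Measurable fun z => ν (Prod.mk (S.rollout l x z) ⁻¹' A) :=
    (measurable_measure_prodMk_left hA).comp ((hS.rollout hl).comp measurable_prodMk_left)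
  simp_rw [doobH_zero, doobH, measureReal_def]
  rw [integral_toReal hsection.aemeasurable (ae_of_all _ fun _ => measure_lt_top _ _)]
  exact congrArg ENNReal.toReal
    (Measure.prod_apply (measurable_prodMk_left (measurableSet_rollout_mem hA hS hl)))

theorem integral_doobH_rollout_smul_last {F : Type*} [NormedAddCommGroup F] [NormedSpace ℝ F]
    [CompleteSpace F] (hA : MeasurableSet A) (hS : S.MeasurableScore) {k : ℕ} (hk : k + 1 ≤ L)
    (x : Vec d) {f : Vec d → F} (hf : Integrable f (stdGaussian (Vec d))) :
    ∫ z, S.doobH ν A 0 (S.rollout (k + 1) x z) • f (z (Fin.last k)) ∂(noiseLaw d (k + 1))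
      = ∫ w, S.doobH ν A k (S.step (k + 1) x w) • f w ∂(stdGaussian (Vec d)) := by
  have hmeas : Measurable fun p : Vec d × (Fin k → Vec d) =>
      S.doobH ν A 0 (S.rollout k (S.step (k + 1) x p.1) p.2) :=
    (measurable_doobH_zero hA).comp ((hS.rollout (by omega)).comp
      (((hS.step (by omega) hk).comp (measurable_const.prodMk measurable_fst)).prodMk
        measurable_snd))
  have hint : Integrable (fun p : Vec d × (Fin k → Vec d) =>
      S.doobH ν A 0 (S.rollout k (S.step (k + 1) x p.1) p.2) • f p.1)
      ((stdGaussian (Vec d)).prod (noiseLaw d k)) :=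
    (hf.comp_fst _).bdd_smul 1 hmeas.aestronglyMeasurable (ae_of_all _ fun _ =>
      abs_doobH_le_one _ _)
  have hsplit := measurePreserving_last_init d k
  calc ∫ z, S.doobH ν A 0 (S.rollout (k + 1) x z) • f (z (Fin.last k)) ∂(noiseLaw d (k + 1))
      = ∫ p, S.doobH ν A 0 (S.rollout k (S.step (k + 1) x p.1) p.2) • f p.1
          ∂((stdGaussian (Vec d)).prod (noiseLaw d k)) := by
        rw [← hsplit.map_eq] at hint ⊢
        exact (integral_map hsplit.measurable.aemeasurable hint.1).symm
    _ = ∫ w, ∫ z, S.doobH ν A 0 (S.rollout k (S.step (k + 1) x w) z) • f w ∂(noiseLaw d k)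
          ∂(stdGaussian (Vec d)) := integral_prod _ hint
    _ = _ := by
        simp_rw [integral_smul_const, ← doobH_eq_integral hA hS (show k ≤ L by omega)]

theorem doobH_succ (hA : MeasurableSet A) (hS : S.MeasurableScore) {k : ℕ} (hk : k + 1 ≤ L)
    (x : Vec d) :
    S.doobH ν A (k + 1) x
      = ∫ w, S.doobH ν A k (S.step (k + 1) x w) ∂(stdGaussian (Vec d)) := by
  simpa [← doobH_eq_integral hA hS hk] using integral_doobH_rollout_smul_last (ν := ν) hA hS hk x
    (f := fun _ => (1 : ℝ)) (integrable_const _)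

end DoobH

section TiltedMarginal

variable {𝒰 : Type*} [MeasurableSpace 𝒰] {ν : Measure 𝒰} [IsProbabilityMeasure ν]
  {A : Set (Vec d × 𝒰)}

theorem eventProb_le_one (hS : S.MeasurableScore) : S.eventProb ν A ≤ 1 := by
  have := hS.isProbabilityMeasure_marginal 0
  exact measureReal_le_one

theorem prod_rollout_mem (hA : MeasurableSet A) (hS : S.MeasurableScore) {l : ℕ} (hl : l ≤ L) :
    ((S.marginal l).prod ((noiseLaw d l).prod ν))
        {p | (S.rollout l p.1 p.2.1, p.2.2) ∈ A} = ENNReal.ofReal (S.eventProb ν A) := by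
  have := hS.isProbabilityMeasure_marginal l
  have := hS.isProbabilityMeasure_marginal 0
  have hrollout : MeasurePreserving (fun p : Vec d × (Fin l → Vec d) => S.rollout l p.1 p.2)
      ((S.marginal l).prod (noiseLaw d l)) (S.marginal 0) :=
    ⟨hS.rollout hl, map_rollout_marginal hS hl⟩
  rw [eventProb, ofReal_measureReal, ← ((hrollout.prod (MeasurePreserving.id ν)).comp
    (measurePreserving_prodAssoc _ _ _).symm).measure_preimage hA.nullMeasurableSet]
  rfl

theorem tiltedMarginal_eq_withDensity (hA : MeasurableSet A) (hS : S.MeasurableScore) {l : ℕ}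
    (hl : l ≤ L) (hpos : 0 < S.eventProb ν A) :
    S.tiltedMarginal ν A l = (S.marginal l).withDensity fun x =>
      ENNReal.ofReal (S.doobH ν A l x / S.eventProb ν A) := by
  have hdensity : ∀ x, ENNReal.ofReal (S.doobH ν A l x / S.eventProb ν A)
      = (ENNReal.ofReal (S.eventProb ν A))⁻¹ *
        (noiseLaw d l).prod ν {p | (S.rollout l x p.1, p.2) ∈ A} := fun x => by
    rw [ENNReal.ofReal_div_of_pos hpos, doobH, ofReal_measureReal, ENNReal.div_eq_inv_mul]
  rw [tiltedMarginal, map_fst_cond_prod (measurableSet_rollout_mem hA hS hl),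
    prod_rollout_mem hA hS hl]
  simp_rw [hdensity]
  exact (withDensity_smul _ (measurable_measure_prodMk_left
    (measurableSet_rollout_mem hA hS hl))).symm

theorem isProbabilityMeasure_tiltedMarginal (hA : MeasurableSet A) (hS : S.MeasurableScore)
    {l : ℕ} (hl : l ≤ L) (hpos : 0 < S.eventProb ν A) :
    IsProbabilityMeasure (S.tiltedMarginal ν A l) := by
  have := hS.isProbabilityMeasure_marginal l
  have := cond_isProbabilityMeasure (μ := (S.marginal l).prod ((noiseLaw d l).prod ν))
    (s := {p | (S.rollout l p.1 p.2.1, p.2.2) ∈ A})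
    (by rw [prod_rollout_mem hA hS hl]; exact (ENNReal.ofReal_pos.2 hpos).ne')
  exact Measure.isProbabilityMeasure_map measurable_fst.aemeasurable

theorem lintegral_tiltedMarginal_le (hA : MeasurableSet A) (hS : S.MeasurableScore) {l : ℕ}
    (hl : l ≤ L) (hpos : 0 < S.eventProb ν A) {f : Vec d → ℝ} (hf : Measurable f) {c : ℝ}
    (hfc : ∀ x, S.doobH ν A l x * f x ≤ c) :
    ∫⁻ x, ENNReal.ofReal (f x) ∂(S.tiltedMarginal ν A l)
      ≤ ENNReal.ofReal (c / S.eventProb ν A) := by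
  have := hS.isProbabilityMeasure_marginal l
  rw [tiltedMarginal_eq_withDensity hA hS hl hpos, lintegral_withDensity_eq_lintegral_mul _
    ((measurable_doobH hA hS hl).div_const _).ennreal_ofReal hf.ennreal_ofReal]
  calc _ ≤ ∫⁻ _, ENNReal.ofReal (c / S.eventProb ν A) ∂(S.marginal l) := by
        refine lintegral_mono fun x => ?_
        rw [Pi.mul_apply, ← ENNReal.ofReal_mul (div_nonneg (doobH_nonneg l x) hpos.le),
          div_mul_eq_mul_div]
        exact ENNReal.ofReal_le_ofReal (div_le_div_of_nonneg_right (hfc x) hpos.le)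
    _ = ENNReal.ofReal (c / S.eventProb ν A) := by simp

theorem ae_doobH_pos (hA : MeasurableSet A) (hS : S.MeasurableScore) {l : ℕ} (hl : l ≤ L)
    (hpos : 0 < S.eventProb ν A) : ∀ᵐ x ∂(S.tiltedMarginal ν A l), 0 < S.doobH ν A l x := by
  rw [tiltedMarginal_eq_withDensity hA hS hl hpos,
    ae_withDensity_iff ((measurable_doobH hA hS hl).div_const _).ennreal_ofReal]
  refine ae_of_all _ fun x hx => ?_
  rw [Ne, ENNReal.ofReal_eq_zero, not_le] at hx
  exact (div_pos_iff_of_pos_right hpos).1 hx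

end TiltedMarginal

end DiffusionSampler

section Entropy

variable {Ω : Type*} [MeasurableSpace Ω] {P : Measure Ω} {g : Ω → ℝ}

theorem integral_withDensity_ofReal_div_integral {E : Type*} [NormedAddCommGroup E]
    [NormedSpace ℝ E] (hg : Measurable g) (hg₀ : ∀ ω, 0 ≤ g ω) (Y : Ω → E) :
    ∫ ω, Y ω ∂(P.withDensity fun ω => ENNReal.ofReal (g ω / ∫ ω', g ω' ∂P))
      = (∫ ω, g ω ∂P)⁻¹ • ∫ ω, g ω • Y ω ∂P := by
  have hdiv : ∀ ω, 0 ≤ g ω / ∫ ω', g ω' ∂P := fun ω =>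
    div_nonneg (hg₀ ω) (integral_nonneg hg₀)
  rw [integral_withDensity_eq_integral_toReal_smul (hg.div_const _).ennreal_ofReal
    (ae_of_all _ fun _ => ENNReal.ofReal_lt_top), ← integral_smul]
  simp_rw [ENNReal.toReal_ofReal (hdiv _), div_eq_inv_mul, mul_smul]

theorem isProbabilityMeasure_withDensity_ofReal_div_integral (hg : Integrable g P)
    (hg₀ : ∀ ω, 0 ≤ g ω) (hpos : 0 < ∫ ω, g ω ∂P) :
    IsProbabilityMeasure (P.withDensity fun ω => ENNReal.ofReal (g ω / ∫ ω', g ω' ∂P)) := by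
  constructor
  rw [withDensity_apply _ .univ, Measure.restrict_univ,
    ← ofReal_integral_eq_lintegral_ofReal (hg.div_const _)
    (ae_of_all _ fun ω => div_nonneg (hg₀ ω) hpos.le), integral_div, div_self hpos.ne',
    ENNReal.ofReal_one]

/-- The density `g / ∫ g` is at most `1 / ∫ g`, so it costs at most `log (1 / ∫ g)` in the exponent
of a square-exponential moment. -/
theorem norm_integral_smul_sq_le_mul_log {E : Type*} [NormedAddCommGroup E] [NormedSpace ℝ E]
    [CompleteSpace E] [IsFiniteMeasure P] {Y : Ω → E} (hY : AEStronglyMeasurable Y P)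
    {c : ℝ} (hc : 0 < c) (hexp : Integrable (fun ω => Real.exp (c * ‖Y ω‖ ^ 2)) P)
    (hg : Measurable g) (hg₀ : ∀ ω, 0 ≤ g ω) (hg₁ : ∀ ω, g ω ≤ 1) (hpos : 0 < ∫ ω, g ω ∂P) :
    ‖∫ ω, g ω • Y ω ∂P‖ ^ 2 ≤ (∫ ω, g ω ∂P) ^ 2 *
      (Real.log ((∫ ω, Real.exp (c * ‖Y ω‖ ^ 2) ∂P) / ∫ ω, g ω ∂P) / c) := by
  have habs : ∀ ω, ‖g ω‖ ≤ 1 := fun ω => by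
    rw [Real.norm_of_nonneg (hg₀ ω)]
    exact hg₁ ω
  have hgexp := hexp.bdd_mul hg.aestronglyMeasurable (ae_of_all _ habs)
  have := isProbabilityMeasure_withDensity_ofReal_div_integral
    (.of_bound hg.aestronglyMeasurable 1 (ae_of_all _ habs)) hg₀ hpos
  have hintegrable : Integrable (fun ω => Real.exp (c * ‖Y ω‖ ^ 2))
      (P.withDensity fun ω => ENNReal.ofReal (g ω / ∫ ω', g ω' ∂P)) := by
    rw [integrable_withDensity_iff_integrable_smul' (hg.div_const _).ennreal_ofReal
      (ae_of_all _ fun _ => ENNReal.ofReal_lt_top)]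
    simp_rw [ENNReal.toReal_ofReal (div_nonneg (hg₀ _) hpos.le), smul_eq_mul, div_mul_eq_mul_div]
    exact hgexp.div_const _
  have hjensen := exp_sq_norm_integral_le (hY.mono_ac (withDensity_absolutelyContinuous _ _)) hc
    hintegrable
  simp only [integral_withDensity_ofReal_div_integral hg hg₀, norm_smul, smul_eq_mul] at hjensen
  have hle : ∫ ω, g ω * Real.exp (c * ‖Y ω‖ ^ 2) ∂P ≤ ∫ ω, Real.exp (c * ‖Y ω‖ ^ 2) ∂P :=
    integral_mono hgexp hexp fun ω => mul_le_of_le_one_left (Real.exp_pos _).le (hg₁ ω)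
  have hbound := hjensen.trans (mul_le_mul_of_nonneg_left hle (inv_nonneg.2 hpos.le))
  have hlog := (Real.le_log_iff_exp_le ((Real.exp_pos _).trans_le hbound)).2 hbound
  rw [norm_inv, Real.norm_of_nonneg hpos.le, inv_mul_eq_div, inv_mul_eq_div, div_pow] at hlog
  rw [← div_le_iff₀' (by positivity), le_div_iff₀' hc]
  exact hlog

end Entropy

section TruncatedRatio

variable {h h' η D c : ℝ}

theorem log_div_nonneg (hh : 0 < h) (hh₁ : h ≤ 1) (hD : 1 ≤ D) : 0 ≤ Real.log (D / h) :=
  Real.log_nonneg ((one_le_div hh).2 (hh₁.trans hD))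

theorem mul_log_div_le (hh : 0 < h) (hhη : h ≤ η) (hη₁ : η ≤ 1) (hD : 1 ≤ D) :
    h * Real.log (D / h) ≤ η * (Real.log (D / η) + 1) := by
  have hη : 0 < η := hh.trans_le hhη
  have hratio : h * Real.log (η / h) ≤ η := by
    have := mul_le_mul_of_nonneg_left (Real.log_le_self (div_pos hη hh).le) hh.le
    rwa [mul_div_cancel₀ _ hh.ne'] at this
  have hsplit : Real.log (D / h) = Real.log (D / η) + Real.log (η / h) := by
    rw [← Real.log_mul (by positivity) (by positivity), div_mul_div_cancel₀ hη.ne']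
  rw [hsplit]
  linarith [mul_le_mul_of_nonneg_right hhη (log_div_nonneg hη hη₁ hD)]

theorem sq_mul_log_div_le (hh : 0 < h) (hη : 0 < η) (hη₁ : η ≤ 1) (hD : 1 ≤ D) :
    h ^ 2 * Real.log (D / h) ≤ (Real.log (D / η) + 1) * max h η ^ 2 := by
  have := log_div_nonneg hη hη₁ hD
  rcases le_total h η with hle | hge
  · calc h ^ 2 * Real.log (D / h) = h * (h * Real.log (D / h)) := by ring
      _ ≤ η * (η * (Real.log (D / η) + 1)) := by
          have hmul := mul_log_div_le hh hle hη₁ hD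
          exact mul_le_mul hle hmul (mul_nonneg hh.le (log_div_nonneg hh (hle.trans hη₁) hD)) hη.le
      _ = (Real.log (D / η) + 1) * max h η ^ 2 := by rw [max_eq_right hle]; ring
  · have hlog : Real.log (D / h) ≤ Real.log (D / η) :=
      Real.log_le_log (by positivity) (div_le_div_of_nonneg_left (by positivity) hη hge)
    rw [max_eq_left hge, mul_comm]
    gcongr
    linarith

theorem norm_add₃_sq_le {F : Type*} [SeminormedAddCommGroup F] (x y z : F) :
    ‖x + y + z‖ ^ 2 ≤ 3 * (‖x‖ ^ 2 + ‖y‖ ^ 2 + ‖z‖ ^ 2) := by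
  have htri := pow_le_pow_left₀ (norm_nonneg _) (norm_add₃_le (a := x) (b := y) (c := z)) 2
  nlinarith [sq_nonneg (‖x‖ - ‖y‖), sq_nonneg (‖y‖ - ‖z‖), sq_nonneg (‖x‖ - ‖z‖)]

variable {F : Type*} [SeminormedAddCommGroup F] [NormedSpace ℝ F] {v v' : F}

theorem norm_smul_sq (r : ℝ) (v : F) : ‖r • v‖ ^ 2 = r ^ 2 * ‖v‖ ^ 2 := by
  rw [norm_smul, mul_pow, Real.norm_eq_abs, sq_abs]

theorem norm_inv_max_sub_inv_max_smul_sq_le {R : ℝ} (hη : 0 < η)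
    (hv : ‖v‖ ^ 2 ≤ R * max h η ^ 2) :
    ‖((max h' η)⁻¹ - (max h η)⁻¹) • v‖ ^ 2 ≤ R * (h' - h) ^ 2 / η ^ 2 := by
  have hmax : 0 < max h η := hη.trans_le (le_max_right _ _)
  have hmax' : 0 < max h' η := hη.trans_le (le_max_right _ _)
  have hdist : (max h η - max h' η) ^ 2 ≤ (h' - h) ^ 2 := by
    rw [sq_le_sq, abs_sub_comm h' h]
    exact abs_max_sub_max_le_abs h h' η
  rw [norm_smul_sq, inv_sub_inv hmax'.ne' hmax.ne', div_pow, mul_pow, div_mul_eq_mul_div,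
    div_le_div_iff₀ (by positivity) (by positivity)]
  calc (max h η - max h' η) ^ 2 * ‖v‖ ^ 2 * η ^ 2
      ≤ (h' - h) ^ 2 * (R * max h η ^ 2) * max h' η ^ 2 := by
        gcongr
        · exact mul_nonneg (sq_nonneg _) ((sq_nonneg _).trans hv)
        · exact le_max_right h' η
    _ = R * (h' - h) ^ 2 * (max h' η ^ 2 * max h η ^ 2) := by ring

theorem norm_inv_max_sub_inv_smul_sq_le {q : ℝ} (hh : 0 < h) (hη : 0 < η)
    (hv : ‖v‖ ^ 2 ≤ h ^ 2 * q) :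
    ‖((max h η)⁻¹ - h⁻¹) • v‖ ^ 2 ≤ if h < η then q else 0 := by
  split_ifs with hlt
  · have hinv : (η⁻¹ - h⁻¹) ^ 2 ≤ h⁻¹ ^ 2 := by
      have := inv_anti₀ hh hlt.le
      have := inv_pos.2 hη
      nlinarith
    rw [max_eq_right hlt.le, norm_smul_sq]
    calc (η⁻¹ - h⁻¹) ^ 2 * ‖v‖ ^ 2 ≤ h⁻¹ ^ 2 * (h ^ 2 * q) := by gcongr
      _ = q := by field_simp
  · simp [max_eq_left (not_lt.1 hlt)]

theorem norm_inv_max_smul_sub_inv_smul_sq_le (hh : 0 < h) (hη : 0 < η) (hη₁ : η ≤ 1) (hc : 0 < c)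
    (hD : 1 ≤ D) (hv : ‖v‖ ^ 2 ≤ h ^ 2 * (Real.log (D / h) / c)) :
    ‖(max h' η)⁻¹ • v' - h⁻¹ • v‖ ^ 2 ≤
      3 * ((1 + (Real.log (D / η) + 1) / c) / η ^ 2 * (‖v' - v‖ ^ 2 + (h' - h) ^ 2)
        + if h < η then Real.log (D / h) / c else 0) := by
  have hR := log_div_nonneg hη hη₁ hD
  have hvmax : ‖v‖ ^ 2 ≤ (Real.log (D / η) + 1) / c * max h η ^ 2 := by
    refine hv.trans ?_
    rw [← mul_div_assoc, div_mul_eq_mul_div]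
    exact div_le_div_of_nonneg_right (sq_mul_log_div_le hh hη hη₁ hD) hc.le
  have hnumerator : ‖(max h' η)⁻¹ • (v' - v)‖ ^ 2 ≤ ‖v' - v‖ ^ 2 / η ^ 2 := by
    rw [norm_smul_sq, inv_pow, inv_mul_eq_div]
    gcongr
    exact le_max_right _ _
  have hdenominator := norm_inv_max_sub_inv_max_smul_sq_le (h' := h') hη hvmax
  have htruncation := norm_inv_max_sub_inv_smul_sq_le hh hη hv
  have hsplit : (max h' η)⁻¹ • v' - h⁻¹ • v = (max h' η)⁻¹ • (v' - v)
      + ((max h' η)⁻¹ - (max h η)⁻¹) • v + ((max h η)⁻¹ - h⁻¹) • v := by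
    simp only [smul_sub, sub_smul]
    abel
  rw [hsplit]
  refine (norm_add₃_sq_le _ _ _).trans ?_
  set R := (Real.log (D / η) + 1) / c
  have : 0 ≤ R := by positivity
  have hexpand : (1 + R) / η ^ 2 * (‖v' - v‖ ^ 2 + (h' - h) ^ 2)
      = ‖v' - v‖ ^ 2 / η ^ 2 + R * (h' - h) ^ 2 / η ^ 2
        + (R * ‖v' - v‖ ^ 2 / η ^ 2 + (h' - h) ^ 2 / η ^ 2) := by ring
  have hrest : 0 ≤ R * ‖v' - v‖ ^ 2 / η ^ 2 + (h' - h) ^ 2 / η ^ 2 := by positivity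
  linarith

end TruncatedRatio

namespace DiffusionSampler

variable {d L : ℕ} {S : DiffusionSampler d L}

section Mean

theorem differentiable_mean {l : ℕ} (hscore : Differentiable ℝ fun x => S.score x (S.t l)) :
    Differentiable ℝ (S.mean l) := by
  unfold mean
  fun_prop

theorem norm_fderiv_mean_le {l : ℕ} {x : Vec d} {G B : ℝ}
    (hscore : DifferentiableAt ℝ (fun x => S.score x (S.t l)) x)
    (hG : ‖fderiv ℝ (fun x' => S.score x' (S.t l)) x‖ ≤ G) (ha : |S.a l| ≤ B)
    (hb : |S.b l| ≤ B) : ‖fderiv ℝ (S.mean l) x‖ ≤ B + B * G := by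
  have hmean : HasFDerivAt (S.mean l) (S.a l • ContinuousLinearMap.id ℝ (Vec d)
      + S.b l • fderiv ℝ (fun x' => S.score x' (S.t l)) x) x :=
    ((hasFDerivAt_id x).const_smul (S.a l)).add (hscore.hasFDerivAt.const_smul (S.b l))
  have hB : 0 ≤ B := (abs_nonneg _).trans ha
  rw [hmean.fderiv]
  refine (norm_add_le _ _).trans (add_le_add ?_ ?_)
  · rw [norm_smul, Real.norm_eq_abs]
    exact (mul_le_of_le_one_right (abs_nonneg _) ContinuousLinearMap.norm_id_le).trans ha
  · rw [norm_smul, Real.norm_eq_abs]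
    exact mul_le_mul hb hG (norm_nonneg _) hB

theorem gradient_log_transitionDensity {l : ℕ} {x : Vec d} (hσ : 0 < S.σ l)
    (hmean : DifferentiableAt ℝ (S.mean l) x) (w : Vec d) :
    gradient (fun x' => Real.log (S.transitionDensity l x' (S.step l x w))) x
      = (S.σ l)⁻¹ • ContinuousLinearMap.adjoint (fderiv ℝ (S.mean l) x) w := by
  have hlog : (fun x' => Real.log (S.transitionDensity l x' (S.step l x w))) = fun x' =>
      Real.log ((2 * Real.pi * S.σ l ^ 2) ^ (-(d : ℝ) / 2))
        + -1 / (2 * S.σ l ^ 2) * ‖S.step l x w - S.mean l x'‖ ^ 2 := by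
    funext x'
    rw [transitionDensity, Real.log_mul (by positivity) (Real.exp_pos _).ne', Real.log_exp]
    congr 1
    ring
  have hresidual : HasFDerivAt (fun x' => S.step l x w - S.mean l x')
      (-(fderiv ℝ (S.mean l) x)) x := hmean.hasFDerivAt.const_sub _
  have hsq := (hasStrictFDerivAt_norm_sq (S.step l x w - S.mean l x)).hasFDerivAt.comp x hresidual
  have hstep : S.step l x w - S.mean l x = S.σ l • w := by simp [step]
  refine HasGradientAt.gradient ?_
  rw [hlog, hasGradientAt_iff_hasFDerivAt]
  refine ((hsq.const_mul (-1 / (2 * S.σ l ^ 2))).const_add _).congr_fderiv ?_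
  ext v
  have hadjoint := ContinuousLinearMap.adjoint_inner_left (fderiv ℝ (S.mean l) x) v w
  simp [hstep, hadjoint]
  field_simp

end Mean

section Estimators

variable {𝒰 : Type*} [MeasurableSpace 𝒰] {ν : Measure 𝒰} {A : Set (Vec d × 𝒰)}

variable (S ν A) in
/-- The Gaussian average `𝔼[h(X_k) Z]` over one reverse step `X_k = μ(x) + σ Z` from `x` at time
`t_{k+1}`. By Gaussian integration by parts, `∇h(x, t_{k+1})` is the transposed Jacobian of the mean
applied to `σ⁻¹ 𝔼[h(X_k) Z]`. -/
noncomputable def weightedNoise (k : ℕ) (x : Vec d) : Vec d :=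
  ∫ w, S.doobH ν A k (S.step (k + 1) x w) • w ∂(stdGaussian (Vec d))

variable (S ν A) in
/-- The Monte Carlo estimator of `weightedNoise`, from the rollouts that also define `hHat` and
`gradHHat`. -/
noncomputable def weightedNoiseHat (k M : ℕ) (z : Fin M → Fin (k + 1) → Vec d) (x : Vec d) :
    Vec d :=
  (1 / (M : ℝ)) • ∑ m, S.doobH ν A 0 (S.rollout (k + 1) x (z m)) • z m (Fin.last k)

variable (S ν A) in
/-- The squared errors at the state `x` of the Monte Carlo estimators of `weightedNoise` and of the
`h`-function, added up. -/
noncomputable def monteCarloSqError (k M : ℕ) (z : Fin M → Fin (k + 1) → Vec d) (x : Vec d) : ℝ :=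
  ‖S.weightedNoiseHat ν A k M z x - S.weightedNoise ν A k x‖ ^ 2
    + (S.hHat ν A (k + 1) M z x - S.doobH ν A (k + 1) x) ^ 2

theorem monteCarloSqError_nonneg (k M : ℕ) (z : Fin M → Fin (k + 1) → Vec d) (x : Vec d) :
    0 ≤ S.monteCarloSqError ν A k M z x := by
  unfold monteCarloSqError
  positivity

theorem gradHHat_eq_smul_adjoint {k M : ℕ} (hσ : 0 < S.σ (k + 1)) {x : Vec d}
    (hmean : DifferentiableAt ℝ (S.mean (k + 1)) x) (z : Fin M → Fin (k + 1) → Vec d) :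
    S.gradHHat ν A k M z x = (S.σ (k + 1))⁻¹ •
      ContinuousLinearMap.adjoint (fderiv ℝ (S.mean (k + 1)) x)
        (S.weightedNoiseHat ν A k M z x) := by
  simp only [gradHHat, weightedNoiseHat, gradient_log_transitionDensity hσ hmean, map_smul, map_sum,
    Finset.smul_sum, smul_comm (S.σ (k + 1))⁻¹]

variable [IsProbabilityMeasure ν]

theorem hasFDerivAt_doobH_succ (hA : MeasurableSet A) (hS : S.MeasurableScore) {k : ℕ}
    (hk : k + 1 ≤ L) (hσ : S.σ (k + 1) ≠ 0) {x : Vec d}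
    (hmean : DifferentiableAt ℝ (S.mean (k + 1)) x) :
    HasFDerivAt (S.doobH ν A (k + 1))
      (((S.σ (k + 1))⁻¹ • innerSL ℝ (S.weightedNoise ν A k x)).comp
        (fderiv ℝ (S.mean (k + 1)) x)) x := by
  rw [show S.doobH ν A (k + 1) = fun x =>
    ∫ w, S.doobH ν A k (S.mean (k + 1) x + S.σ (k + 1) • w) ∂(stdGaussian (Vec d)) from
      funext fun x => doobH_succ hA hS hk x]
  exact (hasFDerivAt_integral_add_smul_stdGaussian (measurable_doobH hA hS (by omega))
    (fun z => abs_doobH_le_one _ _) hσ (S.mean (k + 1) x)).comp x hmean.hasFDerivAt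

theorem gradient_log_doobH (hA : MeasurableSet A) (hS : S.MeasurableScore) {k : ℕ}
    (hk : k + 1 ≤ L) (hσ : S.σ (k + 1) ≠ 0) {x : Vec d}
    (hmean : DifferentiableAt ℝ (S.mean (k + 1)) x) (hx : S.doobH ν A (k + 1) x ≠ 0) :
    gradient (fun x' => Real.log (S.doobH ν A (k + 1) x')) x
      = (S.σ (k + 1))⁻¹ • ContinuousLinearMap.adjoint (fderiv ℝ (S.mean (k + 1)) x)
          ((S.doobH ν A (k + 1) x)⁻¹ • S.weightedNoise ν A k x) := by
  refine HasGradientAt.gradient ?_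
  rw [hasGradientAt_iff_hasFDerivAt]
  refine ((hasFDerivAt_doobH_succ hA hS hk hσ hmean).log hx).congr_fderiv ?_
  ext v
  have hadjoint := ContinuousLinearMap.adjoint_inner_left (fderiv ℝ (S.mean (k + 1)) x) v
    (S.weightedNoise ν A k x)
  simp [hadjoint, mul_left_comm]

theorem norm_gradLogHHat_sub_sq_le (hA : MeasurableSet A) (hS : S.MeasurableScore) {k M : ℕ}
    (hk : k + 1 ≤ L) (hσ : 0 < S.σ (k + 1)) {x : Vec d}
    (hmean : DifferentiableAt ℝ (S.mean (k + 1)) x) (hx : S.doobH ν A (k + 1) x ≠ 0) {K : ℝ}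
    (hK : ‖fderiv ℝ (S.mean (k + 1)) x‖ ≤ K) (η : ℝ) (z : Fin M → Fin (k + 1) → Vec d) :
    ‖S.gradLogHHat ν A k M η z x - gradient (fun x' => Real.log (S.doobH ν A (k + 1) x')) x‖ ^ 2
      ≤ K ^ 2 / S.σ (k + 1) ^ 2 *
        ‖(max (S.hHat ν A (k + 1) M z x) η)⁻¹ • S.weightedNoiseHat ν A k M z x
          - (S.doobH ν A (k + 1) x)⁻¹ • S.weightedNoise ν A k x‖ ^ 2 := by
  rw [gradLogHHat, gradHHat_eq_smul_adjoint hσ hmean,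
    gradient_log_doobH hA hS hk hσ.ne' hmean hx, smul_comm, ← map_smul, ← smul_sub, ← map_sub,
    norm_smul_sq, inv_pow, div_eq_inv_mul, mul_assoc, ← mul_pow]
  gcongr
  refine (ContinuousLinearMap.le_opNorm _ _).trans ?_
  rw [LinearIsometryEquiv.norm_map]
  gcongr

theorem norm_weightedNoise_sq_le (hA : MeasurableSet A) (hS : S.MeasurableScore) {k : ℕ}
    (hk : k + 1 ≤ L) {c : ℝ} (hc : 0 < c)
    (hexp : Integrable (fun w : Vec d => Real.exp (c * ‖w‖ ^ 2)) (stdGaussian (Vec d)))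
    {x : Vec d} (hx : 0 < S.doobH ν A (k + 1) x) :
    ‖S.weightedNoise ν A k x‖ ^ 2 ≤ S.doobH ν A (k + 1) x ^ 2 *
      (Real.log ((∫ w, Real.exp (c * ‖w‖ ^ 2) ∂(stdGaussian (Vec d))) /
        S.doobH ν A (k + 1) x) / c) := by
  have hstep := (hS.step (by omega) hk).comp (measurable_prodMk_left (x := x))
  rw [doobH_succ hA hS hk] at hx ⊢
  exact norm_integral_smul_sq_le_mul_log (Y := fun w : Vec d => w) aestronglyMeasurable_id hc hexp
    ((measurable_doobH hA hS (by omega)).comp hstep) (fun _ => doobH_nonneg _ _)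
    (fun _ => doobH_le_one _ _) hx

theorem measurable_weightedNoise (hA : MeasurableSet A) (hS : S.MeasurableScore) {k : ℕ}
    (hk : k + 1 ≤ L) : Measurable (S.weightedNoise ν A k) := by
  have hintegrand : Measurable fun p : Vec d × Vec d =>
      S.doobH ν A k (S.step (k + 1) p.1 p.2) • p.2 :=
    ((measurable_doobH hA hS (by omega)).comp (hS.step (by omega) hk)).smul measurable_snd
  exact (hintegrand.stronglyMeasurable.integral_prod_right (ν := stdGaussian (Vec d))).measurable

theorem measurable_doobH_rollout (hA : MeasurableSet A) (hS : S.MeasurableScore) {l : ℕ}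
    (hl : l ≤ L) :
    Measurable fun p : Vec d × (Fin l → Vec d) => S.doobH ν A 0 (S.rollout l p.1 p.2) :=
  (measurable_doobH_zero hA).comp (hS.rollout hl)

theorem measurable_hHat (hA : MeasurableSet A) (hS : S.MeasurableScore) {l M : ℕ} (hl : l ≤ L) :
    Measurable fun p : Vec d × (Fin M → Fin l → Vec d) => S.hHat ν A l M p.2 p.1 :=
  (Finset.measurable_fun_sum _ fun m _ => (measurable_doobH_rollout hA hS hl).comp
    (by fun_prop : Measurable fun p : Vec d × (Fin M → Fin l → Vec d) => (p.1, p.2 m))).const_mul _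

theorem measurable_weightedNoiseHat (hA : MeasurableSet A) (hS : S.MeasurableScore) {k M : ℕ}
    (hk : k + 1 ≤ L) :
    Measurable fun p : Vec d × (Fin M → Fin (k + 1) → Vec d) =>
      S.weightedNoiseHat ν A k M p.2 p.1 :=
  (Finset.measurable_fun_sum _ fun m _ => ((measurable_doobH_rollout hA hS hk).comp
    (by fun_prop : Measurable fun p : Vec d × (Fin M → Fin (k + 1) → Vec d) => (p.1, p.2 m))).smul
      (by fun_prop)).const_smul (1 / (M : ℝ))

theorem measurable_monteCarloSqError (hA : MeasurableSet A) (hS : S.MeasurableScore) {k : ℕ}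
    (hk : k + 1 ≤ L) (M : ℕ) :
    Measurable fun p : Vec d × (Fin M → Fin (k + 1) → Vec d) =>
      S.monteCarloSqError ν A k M p.2 p.1 :=
  (((measurable_weightedNoiseHat hA hS hk).sub
      ((measurable_weightedNoise hA hS hk).comp measurable_fst)).norm.pow_const 2).add
    (((measurable_hHat hA hS hk).sub
      ((measurable_doobH hA hS hk).comp measurable_fst)).pow_const 2)

end Estimators

end DiffusionSampler

section WeightedConcentration

theorem exp_mul_norm_toLp_smul_sq_le {E : Type*} [SeminormedAddCommGroup E] [NormedSpace ℝ E]
    {c r : ℝ} (hc : 0 ≤ c) (hr : |r| ≤ 1) (v : E) :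
    Real.exp (c * ‖WithLp.toLp 2 (r • v, r)‖ ^ 2) ≤ Real.exp c * Real.exp (c * ‖v‖ ^ 2) := by
  have hrsq : r ^ 2 ≤ 1 := (sq_le_one_iff_abs_le_one r).2 hr
  rw [← Real.exp_add, Real.exp_le_exp, WithLp.prod_norm_sq_eq_of_L2]
  simp only [WithLp.toLp_fst, WithLp.toLp_snd, norm_smul_sq, Real.norm_eq_abs, sq_abs]
  calc c * (r ^ 2 * ‖v‖ ^ 2 + r ^ 2) ≤ c * (1 * ‖v‖ ^ 2 + 1) := by gcongr
    _ = c + c * ‖v‖ ^ 2 := by ring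

variable {Ω : Type*} [MeasurableSpace Ω] {P : Measure Ω} [IsProbabilityMeasure P]
  {E : Type*} [NormedAddCommGroup E] [InnerProductSpace ℝ E] [FiniteDimensional ℝ E]
  [MeasurableSpace E] [BorelSpace E] {Z : Ω → E} {g : Ω → ℝ} {a c : ℝ}

/-- The errors of both averages are the components of the error of the average of `(g Z, g)`. -/
theorem lintegral_exp_sq_weighted_average_sub_integral_le (hZ : Measurable Z) (hg : Measurable g)
    (hg₁ : ∀ ω, |g ω| ≤ 1) (hc : 0 < c)
    (hexp : Integrable (fun ω => Real.exp (c * ‖Z ω‖ ^ 2)) P) (ha : 0 < a)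
    (hgauss : Integrable (fun u : WithLp 2 (E × ℝ) => Real.exp (a * ‖u‖ ^ 2)) (stdGaussian _))
    (ι : Type*) [Fintype ι] [Nonempty ι] :
    ∫⁻ z, ENNReal.ofReal (Real.exp
        (a * c / (4 * (Real.exp c * ∫ ω, Real.exp (c * ‖Z ω‖ ^ 2) ∂P) ^ 2) * Fintype.card ι *
          (‖(Fintype.card ι : ℝ)⁻¹ • ∑ i, g (z i) • Z (z i) - ∫ ω, g ω • Z ω ∂P‖ ^ 2
            + ((Fintype.card ι : ℝ)⁻¹ * ∑ i, g (z i) - ∫ ω, g ω ∂P) ^ 2)))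
        ∂(Measure.pi fun _ : ι => P)
      ≤ ENNReal.ofReal
          (∫ u : WithLp 2 (E × ℝ), Real.exp (a * ‖u‖ ^ 2) ∂(stdGaussian _)) := by
  set Y : Ω → WithLp 2 (E × ℝ) := fun ω => WithLp.toLp 2 (g ω • Z ω, g ω)
  have hY : Measurable Y := WithLp.measurable_toLp 2 _ |>.comp ((hg.smul hZ).prodMk hg)
  have hYle : ∀ ω, Real.exp (c * ‖Y ω‖ ^ 2) ≤ Real.exp c * Real.exp (c * ‖Z ω‖ ^ 2) :=
    fun ω => exp_mul_norm_toLp_smul_sq_le hc.le (hg₁ ω) (Z ω)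
  have hYexp : Integrable (fun ω => Real.exp (c * ‖Y ω‖ ^ 2)) P :=
    (hexp.const_mul _).mono' (by fun_prop) (ae_of_all _ fun ω => by
      rw [Real.norm_of_nonneg (Real.exp_pos _).le]
      exact hYle ω)
  have hYD := integral_mono hYexp (hexp.const_mul _) hYle
  rw [integral_const_mul] at hYD
  have hYint := integrable_of_integrable_exp_sq hY.aestronglyMeasurable hc hYexp
  refine (lintegral_congr fun z => ?_).trans_le
    (lintegral_exp_sq_average_sub_integral_le (ι := ι) hY hc hYexp ha hgauss hYD)
  rw [WithLp.prod_norm_sq_eq_of_L2]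
  have hfst : (∑ i, Y (z i)).fst = ∑ i, g (z i) • Z (z i) := map_sum (WithLp.fstL 2 ℝ E ℝ) _ _
  have hsnd : (∑ i, Y (z i)).snd = ∑ i, g (z i) := map_sum (WithLp.sndL 2 ℝ E ℝ) _ _
  simp [fst_integral_withLp hYint, snd_integral_withLp hYint, hfst, hsnd, Y]

end WeightedConcentration

namespace DiffusionSampler

variable {d L : ℕ} {S : DiffusionSampler d L} {𝒰 : Type*} [MeasurableSpace 𝒰] {ν : Measure 𝒰}
  [IsProbabilityMeasure ν] {A : Set (Vec d × 𝒰)}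

theorem lintegral_exp_monteCarloSqError_le {a c : ℝ} (hc : 0 < c)
    (hexp : Integrable (fun w => Real.exp (c * ‖w‖ ^ 2)) (stdGaussian (Vec d))) (ha : 0 < a)
    (hgauss : Integrable (fun u : WithLp 2 (Vec d × ℝ) => Real.exp (a * ‖u‖ ^ 2)) (stdGaussian _))
    (hA : MeasurableSet A) (hS : S.MeasurableScore) {k M : ℕ} (hk : k + 1 ≤ L) [NeZero M]
    (x : Vec d) :
    ∫⁻ z, ENNReal.ofReal (Real.exp (a * c /
        (4 * (Real.exp c * ∫ w, Real.exp (c * ‖w‖ ^ 2) ∂(stdGaussian (Vec d))) ^ 2) * M *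
          S.monteCarloSqError ν A k M z x)) ∂(mcLaw d (k + 1) M)
      ≤ ENNReal.ofReal
          (∫ u : WithLp 2 (Vec d × ℝ), Real.exp (a * ‖u‖ ^ 2) ∂(stdGaussian _)) := by
  have hlast := measurePreserving_last d k
  have hmoment : ∫ z, Real.exp (c * ‖z (Fin.last k)‖ ^ 2) ∂(noiseLaw d (k + 1))
      = ∫ w, Real.exp (c * ‖w‖ ^ 2) ∂(stdGaussian (Vec d)) := by
    rw [← hlast.map_eq, integral_map hlast.measurable.aemeasurable (by fun_prop)]
  have hbound := lintegral_exp_sq_weighted_average_sub_integral_le hlast.measurable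
    ((measurable_doobH_rollout (ν := ν) hA hS hk).comp (measurable_prodMk_left (x := x)))
    (fun _ => abs_doobH_le_one _ _) hc (hlast.integrable_comp_of_integrable hexp) ha hgauss (Fin M)
  have hweighted := integral_doobH_rollout_smul_last (ν := ν) hA hS hk x (f := fun w => w)
    IsGaussian.integrable_id
  simp only [Function.comp_apply, hmoment, Fintype.card_fin, ← doobH_eq_integral hA hS hk,
    hweighted, ← one_div] at hbound
  exact hbound

theorem exists_ofReal_one_sub_le_measure_monteCarloSqError_le (d : ℕ) :
    ∃ κ D : ℝ, 0 < κ ∧ 1 ≤ D ∧ ∀ {L : ℕ} {S : DiffusionSampler d L} {𝒰 : Type*}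
      [MeasurableSpace 𝒰] {ν : Measure 𝒰} [IsProbabilityMeasure ν] {A : Set (Vec d × 𝒰)},
      MeasurableSet A → S.MeasurableScore → ∀ {k M : ℕ}, k + 1 ≤ L → 0 < M →
      ∀ (T : Measure (Vec d)) [IsProbabilityMeasure T] {δ : ℝ}, 0 < δ →
      ENNReal.ofReal (1 - δ) ≤ mcLaw d (k + 1) M
        {z | ∫⁻ x, ENNReal.ofReal (κ * M * S.monteCarloSqError ν A k M z x) ∂T
          ≤ ENNReal.ofReal (Real.log (D / δ))} := by
  obtain ⟨c, hc, hexp⟩ := IsGaussian.exists_integrable_exp_sq (stdGaussian (Vec d))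
  obtain ⟨a, ha, hgauss⟩ := IsGaussian.exists_integrable_exp_sq
    (stdGaussian (WithLp 2 (Vec d × ℝ)))
  have hD := one_le_integral_exp_sq hc hexp
  have hD' := one_le_integral_exp_sq ha hgauss
  have := one_pos.trans_le hD
  refine ⟨a * c / (4 * (Real.exp c * ∫ w, Real.exp (c * ‖w‖ ^ 2) ∂(stdGaussian (Vec d))) ^ 2),
    ∫ u : WithLp 2 (Vec d × ℝ), Real.exp (a * ‖u‖ ^ 2) ∂(stdGaussian _), by positivity, hD', ?_⟩
  intro L S 𝒰 _ ν _ A hA hS k M hk hM T _ δ hδ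
  have : NeZero M := ⟨hM.ne'⟩
  exact one_sub_le_measure_lintegral_le_log
    ((measurable_monteCarloSqError hA hS hk M).const_mul _) (fun x z =>
      mul_nonneg (by positivity) (monteCarloSqError_nonneg _ _ _ _)) (one_pos.trans_le hD') hδ
    (lintegral_exp_monteCarloSqError_le hc hexp ha hgauss hA hS hk)

variable {k M : ℕ} {c D K η : ℝ}

theorem lintegral_tiltedMarginal_ite_log_div_le (hA : MeasurableSet A) (hS : S.MeasurableScore)
    {l : ℕ} (hl : l ≤ L) (hpos : 0 < S.eventProb ν A) (hc : 0 < c) (hD : 1 ≤ D) (hη : 0 < η)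
    (hη₁ : η ≤ 1) :
    ∫⁻ x, ENNReal.ofReal
        (if S.doobH ν A l x < η then Real.log (D / S.doobH ν A l x) / c else 0)
        ∂(S.tiltedMarginal ν A l)
      ≤ ENNReal.ofReal (η * ((Real.log (D / η) + 1) / c) / S.eventProb ν A) := by
  have hlog := log_div_nonneg hη hη₁ hD
  have hdoob := measurable_doobH (ν := ν) hA hS hl
  refine lintegral_tiltedMarginal_le hA hS hl hpos (Measurable.ite
    (measurableSet_lt hdoob measurable_const) ((hdoob.const_div D).log.div_const c)
    measurable_const) fun x => ?_
  split_ifs with hlt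
  · rcases (doobH_nonneg (S := S) (ν := ν) (A := A) l x).eq_or_lt with hzero | hx
    · rw [← hzero, zero_mul]
      positivity
    · rw [← mul_div_assoc, ← mul_div_assoc]
      exact div_le_div_of_nonneg_right (mul_log_div_le hx hlt.le hη₁ hD) hc.le
  · rw [mul_zero]
    positivity

theorem enorm_gradLogHHat_sub_sq_le (hA : MeasurableSet A) (hS : S.MeasurableScore)
    (hk : k + 1 ≤ L) (hσ : 0 < S.σ (k + 1)) {x : Vec d}
    (hmean : DifferentiableAt ℝ (S.mean (k + 1)) x) (hK : ‖fderiv ℝ (S.mean (k + 1)) x‖ ≤ K)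
    (hc : 0 < c) (hD : 1 ≤ D) (hη : 0 < η) (hη₁ : η ≤ 1) (z : Fin M → Fin (k + 1) → Vec d)
    (hx : 0 < S.doobH ν A (k + 1) x)
    (hnoise : ‖S.weightedNoise ν A k x‖ ^ 2 ≤ S.doobH ν A (k + 1) x ^ 2 *
      (Real.log (D / S.doobH ν A (k + 1) x) / c)) {s : ℝ} (hs : 0 < s) :
    ‖S.gradLogHHat ν A k M η z x
        - gradient (fun x' => Real.log (S.doobH ν A (k + 1) x')) x‖ₑ ^ 2
      ≤ ENNReal.ofReal (3 * K ^ 2 / S.σ (k + 1) ^ 2) *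
        (ENNReal.ofReal ((1 + (Real.log (D / η) + 1) / c) / η ^ 2 / s) *
            ENNReal.ofReal (s * S.monteCarloSqError ν A k M z x)
          + ENNReal.ofReal (if S.doobH ν A (k + 1) x < η then
              Real.log (D / S.doobH ν A (k + 1) x) / c else 0)) := by
  have hlog := log_div_nonneg hη hη₁ hD
  have hlogx := log_div_nonneg hx (doobH_le_one (ν := ν) (A := A) (S := S) (k + 1) x) hD
  have herror := S.monteCarloSqError_nonneg (ν := ν) (A := A) k M z x
  rw [← ofReal_norm, ← ENNReal.ofReal_pow (norm_nonneg _), ← ENNReal.ofReal_mul (by positivity),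
    ← ENNReal.ofReal_add (by positivity) (by positivity), ← ENNReal.ofReal_mul (by positivity)]
  refine ENNReal.ofReal_le_ofReal
    ((norm_gradLogHHat_sub_sq_le hA hS hk hσ hmean hx.ne' hK η z).trans ?_)
  refine (mul_le_mul_of_nonneg_left (norm_inv_max_smul_sub_inv_smul_sq_le hx hη hη₁ hc hD hnoise)
    (by positivity)).trans_eq ?_
  rw [← mul_assoc _ s, div_mul_cancel₀ _ hs.ne', monteCarloSqError]
  ring

theorem mse_le (hA : MeasurableSet A) (hS : S.MeasurableScore) (hpos : 0 < S.eventProb ν A)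
    (hk : k + 1 ≤ L) (hσ : 0 < S.σ (k + 1)) (hmean : Differentiable ℝ (S.mean (k + 1)))
    (hK : ∀ x, ‖fderiv ℝ (S.mean (k + 1)) x‖ ≤ K) (hc : 0 < c) (hD : 1 ≤ D)
    (hnoise : ∀ x, 0 < S.doobH ν A (k + 1) x → ‖S.weightedNoise ν A k x‖ ^ 2 ≤
      S.doobH ν A (k + 1) x ^ 2 * (Real.log (D / S.doobH ν A (k + 1) x) / c))
    (hη : 0 < η) (hη₁ : η ≤ 1) {z : Fin M → Fin (k + 1) → Vec d} {s t : ℝ} (hs : 0 < s)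
    (ht : 0 ≤ t)
    (herror : ∫⁻ x, ENNReal.ofReal (s * S.monteCarloSqError ν A k M z x)
      ∂(S.tiltedMarginal ν A (k + 1)) ≤ ENNReal.ofReal t) :
    S.mse ν A k M η z ≤ ENNReal.ofReal (3 * K ^ 2 / S.σ (k + 1) ^ 2 *
      ((1 + (Real.log (D / η) + 1) / c) / η ^ 2 / s * t
        + η * ((Real.log (D / η) + 1) / c) / S.eventProb ν A)) := by
  have hlog := log_div_nonneg hη hη₁ hD
  have hmeas : Measurable fun x => ENNReal.ofReal (s * S.monteCarloSqError ν A k M z x) :=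
    (((measurable_monteCarloSqError hA hS hk M).comp
      (measurable_prodMk_right (y := z))).const_mul s).ennreal_ofReal
  have hpointwise := (ae_doobH_pos hA hS hk hpos).mono fun x hx =>
    enorm_gradLogHHat_sub_sq_le hA hS hk hσ (hmean x) (hK x) hc hD hη hη₁ z hx (hnoise x hx) hs
  refine (lintegral_mono_ae hpointwise).trans ?_
  rw [lintegral_const_mul' _ _ ENNReal.ofReal_ne_top, lintegral_add_left (hmeas.const_mul _),
    lintegral_const_mul _ hmeas, ENNReal.ofReal_mul (by positivity),
    ENNReal.ofReal_add (by positivity) (by positivity), ENNReal.ofReal_mul (by positivity)]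
  gcongr
  exact lintegral_tiltedMarginal_ite_log_div_le hA hS hk hpos hc hD hη hη₁

end DiffusionSampler

section Rate

variable {D D' c κ p y ℓ δ : ℝ}

theorem log_div_inv_add_one_le (hD : 1 ≤ D) (hy : 1 ≤ y) {u : ℝ} (hu : 1 / 2 ≤ u)
    (hlog : Real.log y ≤ u) :
    Real.log (D / y⁻¹) + 1 ≤ (2 * Real.log D + 3) * u := by
  rw [div_inv_eq_mul, Real.log_mul (by positivity) (by positivity)]
  nlinarith [mul_le_mul_of_nonneg_left hu (Real.log_nonneg hD)]

theorem variance_add_bias_le (hD : 1 ≤ D) (hD' : 1 ≤ D') (hc : 0 < c) (hκ : 0 < κ) (hp : 0 < p)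
    (hp₁ : p ≤ 1) (hy : 1 ≤ y) (hδ : 0 < δ) (hδ₁ : δ ≤ 1) (hℓ : 1 / 2 ≤ ℓ)
    (hyℓ : Real.log y ≤ ℓ) (hδℓ : Real.log (1 / δ) ≤ ℓ) :
    (1 + (Real.log (D / y⁻¹) + 1) / c) / y⁻¹ ^ 2 / (κ * y ^ 6) * Real.log (D' / δ)
        + y⁻¹ * ((Real.log (D / y⁻¹) + 1) / c) / p
      ≤ ((1 + (2 * Real.log D + 3) / c) * (2 * Real.log D' + 1) / κ + (2 * Real.log D + 3) / c) / p
        * (ℓ / y) := by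
  have hlogD := Real.log_nonneg hD
  have hlogD' := Real.log_nonneg hD'
  have hlogDδ := log_div_nonneg hδ hδ₁ hD'
  have hconfidence : Real.log (D' / δ) ≤ (2 * Real.log D' + 1) * ℓ := by
    rw [← mul_one_div, Real.log_mul (by positivity) (by positivity)]
    nlinarith [mul_le_mul_of_nonneg_left hℓ hlogD']
  have hgrowth : 1 + (Real.log (D / y⁻¹) + 1) / c ≤ (1 + (2 * Real.log D + 3) / c) * y := by
    have := log_div_inv_add_one_le hD hy (by linarith) (Real.log_le_self (by positivity) : _ ≤ y)
    calc 1 + (Real.log (D / y⁻¹) + 1) / c ≤ y + (2 * Real.log D + 3) * y / c := by gcongr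
      _ = _ := by ring
  have hvariance : (1 + (Real.log (D / y⁻¹) + 1) / c) / y⁻¹ ^ 2 / (κ * y ^ 6) * Real.log (D' / δ)
      ≤ (1 + (2 * Real.log D + 3) / c) * (2 * Real.log D' + 1) / κ * (ℓ / y) / p := by
    calc _ ≤ (1 + (2 * Real.log D + 3) / c) * y / y⁻¹ ^ 2 / (κ * y ^ 6) *
          ((2 * Real.log D' + 1) * ℓ) := by gcongr
      _ = (1 + (2 * Real.log D + 3) / c) * (2 * Real.log D' + 1) / κ * (ℓ / y ^ 3) := by
          field_simp
      _ ≤ (1 + (2 * Real.log D + 3) / c) * (2 * Real.log D' + 1) / κ * (ℓ / y) := by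
          gcongr
          exact le_self_pow₀ hy (by norm_num)
      _ ≤ _ := le_div_self (by positivity) hp hp₁
  have hbias : y⁻¹ * ((Real.log (D / y⁻¹) + 1) / c) / p
      ≤ (2 * Real.log D + 3) / c * (ℓ / y) / p := by
    have := log_div_inv_add_one_le hD hy hℓ hyℓ
    calc _ ≤ y⁻¹ * ((2 * Real.log D + 3) * ℓ / c) / p := by gcongr
      _ = _ := by ring
  refine (add_le_add hvariance hbias).trans_eq ?_
  ring

theorem half_le_log_div {M : ℝ} (hM : 2 ≤ M) (hδ : 0 < δ) (hδ₁ : δ ≤ 1) :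
    1 / 2 ≤ Real.log (M / δ) := by
  have hlog2 : Real.log 2 ≤ Real.log (M / δ) :=
    Real.log_le_log two_pos (hM.trans (le_div_self (by linarith) hδ hδ₁))
  linarith [Real.log_two_gt_d9]

theorem variance_add_bias_rpow_le {M : ℝ} (hD : 1 ≤ D) (hD' : 1 ≤ D') (hc : 0 < c) (hκ : 0 < κ)
    (hp : 0 < p) (hp₁ : p ≤ 1) (hδ : 0 < δ) (hδ₁ : δ ≤ 1) (hM : 2 ≤ M) :
    (1 + (Real.log (D / M ^ (-(1 / 6) : ℝ)) + 1) / c) / (M ^ (-(1 / 6) : ℝ)) ^ 2 / (κ * M)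
          * Real.log (D' / δ)
        + M ^ (-(1 / 6) : ℝ) * ((Real.log (D / M ^ (-(1 / 6) : ℝ)) + 1) / c) / p
      ≤ ((1 + (2 * Real.log D + 3) / c) * (2 * Real.log D' + 1) / κ + (2 * Real.log D + 3) / c) / p
        * (Real.log (M / δ) / M ^ (1 / 6 : ℝ)) := by
  have hM₁ : 1 ≤ M := one_le_two.trans hM
  have hM₀ : 0 < M := one_pos.trans_le hM₁
  have hpow : (M ^ (1 / 6 : ℝ)) ^ 6 = M := by
    rw [← Real.rpow_mul_natCast hM₀.le]
    norm_num
  have hlogpow : Real.log (M ^ (1 / 6 : ℝ)) ≤ Real.log (M / δ) :=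
    Real.log_le_log (by positivity) ((Real.rpow_le_self_of_one_le hM₁ (by norm_num)).trans
      (le_div_self hM₀.le hδ hδ₁))
  have hlogδ : Real.log (1 / δ) ≤ Real.log (M / δ) :=
    Real.log_le_log (by positivity) (div_le_div_of_nonneg_right hM₁ hδ.le)
  have hrate := variance_add_bias_le hD hD' hc hκ hp hp₁ (Real.one_le_rpow hM₁ (by norm_num))
    hδ hδ₁ (half_le_log_div hM hδ hδ₁) hlogpow hlogδ
  rwa [hpow, ← Real.rpow_neg hM₀.le] at hrate

theorem div_mul_log_div_le_mul_sqrt {C σ ρ δ₀ M : ℝ} (hC : 0 ≤ C) (hρ : 0 < ρ) (hρp : ρ ≤ p)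
    (hδ : 0 < δ) (hδδ₀ : δ ≤ δ₀) (hδ₀ : δ₀ < 1) (hM : 1 ≤ M) (hy : 0 ≤ y) :
    C / (σ ^ 2 * p) * (Real.log (M / δ) / y)
      ≤ C / (ρ * √(Real.log (1 / δ₀))) *
        (1 / σ ^ 2 * (Real.log (M / δ) * √(Real.log (1 / δ)) / y)) := by
  have hδ₀pos : 0 < δ₀ := hδ.trans_le hδδ₀
  have hsqrt₀ : 0 < √(Real.log (1 / δ₀)) :=
    Real.sqrt_pos.2 (Real.log_pos (one_lt_one_div hδ₀pos hδ₀))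
  have hsqrt : √(Real.log (1 / δ₀)) ≤ √(Real.log (1 / δ)) :=
    Real.sqrt_le_sqrt (Real.log_le_log (by positivity) (one_div_le_one_div_of_le hδ hδδ₀))
  have hlog : 0 ≤ Real.log (M / δ) := log_div_nonneg hδ (hδδ₀.trans hδ₀.le) hM
  calc C / (σ ^ 2 * p) * (Real.log (M / δ) / y)
      = C * (1 / σ ^ 2 * (Real.log (M / δ) / y)) / p := by ring
    _ ≤ C * (1 / σ ^ 2 * (Real.log (M / δ) / y)) / ρ *
          (√(Real.log (1 / δ)) / √(Real.log (1 / δ₀))) := by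
        refine (div_le_div_of_nonneg_left (by positivity) hρ hρp).trans ?_
        exact le_mul_of_one_le_right (by positivity) ((one_le_div hsqrt₀).2 hsqrt)
    _ = _ := by ring

end Rate

namespace DiffusionSampler

variable {d L : ℕ} {S : DiffusionSampler d L} {𝒰 : Type*} [MeasurableSpace 𝒰] {ν : Measure 𝒰}
  {A : Set (Vec d × 𝒰)} {ρ G B : ℝ}

theorem Regular.measurableScore (hreg : S.Regular ν A ρ G) : S.MeasurableScore :=
  fun l hl hlL => (hreg.score_differentiable l hl hlL).continuous.measurable

theorem Regular.differentiable_mean (hreg : S.Regular ν A ρ G) {l : ℕ} (hl : 1 ≤ l)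
    (hlL : l ≤ L) : Differentiable ℝ (S.mean l) :=
  DiffusionSampler.differentiable_mean (hreg.score_differentiable l hl hlL)

theorem Regular.norm_fderiv_mean_le (hreg : S.Regular ν A ρ G) (hcoeff : S.CoeffBounded B) {l : ℕ}
    (hl : 1 ≤ l) (hlL : l ≤ L) (x : Vec d) : ‖fderiv ℝ (S.mean l) x‖ ≤ B + B * G :=
  DiffusionSampler.norm_fderiv_mean_le (hreg.score_differentiable l hl hlL x)
    (hreg.score_fderiv_le l hl hlL x) (hcoeff l hl hlL).1 (hcoeff l hl hlL).2

end DiffusionSampler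

theorem mainTheorem2_general (d : ℕ) : ∃ C : ℝ, 0 < C ∧
    ∀ (L : ℕ) (S : DiffusionSampler d L) (𝒰 : Type*) [MeasurableSpace 𝒰] (ν : Measure 𝒰)
      [IsProbabilityMeasure ν] (A : Set (Vec d × 𝒰)),
      MeasurableSet A → S.MeasurableScore → 0 < S.eventProb ν A →
      ∀ k : ℕ, k + 1 ≤ L → 0 < S.σ (k + 1) → Differentiable ℝ (S.mean (k + 1)) →
      ∀ K : ℝ, (∀ x, ‖fderiv ℝ (S.mean (k + 1)) x‖ ≤ K) →
      ∀ δ : ℝ, 0 < δ → δ ≤ 1 → ∀ M : ℕ, 2 ≤ M →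
        ENNReal.ofReal (1 - δ) ≤
          mcLaw d (k + 1) M {z | S.mse ν A k M ((M : ℝ) ^ (-(1 / 6) : ℝ)) z ≤
            ENNReal.ofReal (C * K ^ 2 / (S.σ (k + 1) ^ 2 * S.eventProb ν A) *
              (Real.log (M / δ) / (M : ℝ) ^ (1 / 6 : ℝ)))} := by
  obtain ⟨c, hc, hexp⟩ := IsGaussian.exists_integrable_exp_sq (stdGaussian (Vec d))
  obtain ⟨κ, D', hκ, hD', hconcentration⟩ :=
    DiffusionSampler.exists_ofReal_one_sub_le_measure_monteCarloSqError_le d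
  have hD := one_le_integral_exp_sq hc hexp
  set D := ∫ w, Real.exp (c * ‖w‖ ^ 2) ∂(stdGaussian (Vec d))
  have hlogD := Real.log_nonneg hD
  have hlogD' := Real.log_nonneg hD'
  refine ⟨3 * ((1 + (2 * Real.log D + 3) / c) * (2 * Real.log D' + 1) / κ
    + (2 * Real.log D + 3) / c), by positivity, ?_⟩
  intro L S 𝒰 _ ν _ A hA hS hpos k hk hσ hmean K hK δ hδ hδ₁ M hM
  have hM₂ : (2 : ℝ) ≤ M := by exact_mod_cast hM
  have hM₀ : (0 : ℝ) < M := two_pos.trans_le hM₂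
  have := DiffusionSampler.isProbabilityMeasure_tiltedMarginal (ν := ν) hA hS hk hpos
  refine (hconcentration (ν := ν) hA hS hk (by omega) (S.tiltedMarginal ν A (k + 1)) hδ).trans
    (measure_mono (Set.ofPred_subset_ofPred.2 fun z hz => ?_))
  refine (DiffusionSampler.mse_le hA hS hpos hk hσ hmean hK hc hD
    (fun x => DiffusionSampler.norm_weightedNoise_sq_le hA hS hk hc hexp) (by positivity)
    (Real.rpow_le_one_of_one_le_of_nonpos (by linarith) (by norm_num)) (mul_pos hκ hM₀)
    (log_div_nonneg hδ hδ₁ hD') hz).trans (ENNReal.ofReal_le_ofReal ?_)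
  refine (mul_le_mul_of_nonneg_left (variance_add_bias_rpow_le hD hD' hc hκ hpos
    (DiffusionSampler.eventProb_le_one hS) hδ hδ₁ hM₂) (by positivity)).trans_eq ?_
  ring

theorem mainTheorem2 (d : ℕ) (ρ G B δ₀ : ℝ) (hρ : 0 < ρ) (hρ1 : ρ ≤ 1) (hG : 0 < G)
    (hB : 0 < B) (hδ₀ : 0 < δ₀) (hδ₀1 : δ₀ < 1) :
    ∃ (C : ℝ) (M₀ : ℕ), 0 < C ∧ 0 < M₀ ∧
      ∀ (L : ℕ) (S : DiffusionSampler d L) (𝒰 : Type*) [MeasurableSpace 𝒰] (ν : Measure 𝒰)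
        [IsProbabilityMeasure ν] (A : Set (Vec d × 𝒰)),
        MeasurableSet A → S.Regular ν A ρ G → S.CoeffBounded B →
        ∀ k : ℕ, k + 1 ≤ L → 0 < S.σ (k + 1) →
        ∀ δ : ℝ, 0 < δ → δ ≤ δ₀ →
        ∀ M : ℕ, M₀ ≤ M →
          ENNReal.ofReal (1 - δ) ≤
            mcLaw d (k + 1) M {z | S.mse ν A k M ((M : ℝ) ^ (-(1 / 6) : ℝ)) z ≤
              ENNReal.ofReal (C * (1 / S.σ (k + 1) ^ 2 *
                (Real.log (M / δ) * √(Real.log (1 / δ)) / (M : ℝ) ^ (1 / 6 : ℝ))))} := by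
  obtain ⟨C, hC, hbound⟩ := mainTheorem2_general d
  have hsqrt : 0 < √(Real.log (1 / δ₀)) := Real.sqrt_pos.2 (Real.log_pos (one_lt_one_div hδ₀ hδ₀1))
  refine ⟨C * (B + B * G) ^ 2 / (ρ * √(Real.log (1 / δ₀))), 2, by positivity, two_pos, ?_⟩
  intro L S 𝒰 _ ν _ A hA hreg hcoeff k hk hσ δ hδ hδδ₀ M hM
  refine (hbound L S 𝒰 ν A hA hreg.measurableScore (hρ.trans_le hreg.eventProb_ge) k hk hσ
    (hreg.differentiable_mean k.succ_pos hk) _ (hreg.norm_fderiv_mean_le hcoeff k.succ_pos hk)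
    δ hδ (hδδ₀.trans hδ₀1.le) M hM).trans (measure_mono (Set.ofPred_subset_ofPred.2 fun z hz =>
      hz.trans (ENNReal.ofReal_le_ofReal ?_)))
  exact div_mul_log_div_le_mul_sqrt (by positivity) hρ hreg.eventProb_ge hδ hδδ₀ hδ₀1
    (by exact_mod_cast one_le_two.trans hM) (by positivity)
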